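/- **Setting.** Let $X$ be a smooth finite-dimensional manifold, $G$ a finite-dimensional Lie group with Lie algebra $\mathfrak g$, $\pi:P\to X$ a smooth principal $G$-bundle with right action $\rho_g(u)=u\cdot g$, and $V$ a finite-dimensional real vector space with a smooth linear representation of $G$; we write $A\cdot v$ for the derived action of $\mathfrak g$. Let $V_G=P\times_G V$. A $V$-valued form $\Theta$ on $P$ is horizontal if it vanishes whenever one of its arguments is in $\ker d\pi$, and $G$-equivariant if $\rho_g^*\Theta=g^{-1}\cdot\Theta$. A form $\phi\in\Omega^p(X;V_G)$ is given by its local representatives: smooth forms $\phi_\sigma\in\Omega^p(U;V)$, one for each smooth local section $\sigma:U\to P$ over an open set $U\subseteq X$, with $\phi_{\tau}=\gamma^{-1}\cdot\phi_\sigma$ whenever $\tau=\sigma\cdot\gamma$ on the overlap of the domains. It corresponds to the smooth horizontal $G$-equivariant form $\tilde\phi\in\Omega^p(P;V)$, given by $\tilde\phi_u=(d\pi_u)^*(\phi_\sigma)_{\pi(u)}$ for any local section $\sigma$ through $u$, for which $\phi_\sigma=\sigma^*\tilde\phi$. The same applies to $P\times_G\mathfrak g$, with the adjoint representation. A connection is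 a smooth $\tilde\omega\in\Omega^1(P;\mathfrak g)$ with $\rho_g^*\tilde\omega=\mathrm{Ad}_{g^{-1}}\tilde\omega$ and $\tilde\omega(A^\#)=A$ for all fundamental vector fields $A^\#$, $A\in\mathfrak g$; its local representatives are $\omega_\sigma=\sigma^*\tilde\omega$. A linear lift is an $\mathbb R$-linear map $\xi\mapsto\tilde\xi$ from smooth vector fields on $X$ to smooth $G$-invariant vector fields on $P$ with $d\pi(\tilde\xi)=\xi\circ\pi$. Lie derivatives of vector-space-valued forms are $L_Z=d\,\iota_Z+\iota_Z\,d$ (with $\iota_Z=0$ on $0$-forms). In terms of local representatives, put $d^\omega\phi=d\phi+\omega\wedge\phi$ for $V$-valued forms $\phi$, $d^\omega\beta=d\beta+[\omega,\beta]$ for $\mathfrak g$-valued functions $\beta$, and $F_\omega=d\omega+\tfrac12[\omega\wedge\omega]$; wedge products of $\mathfrak g$-valued with $V$-valued forms are formed with the derived action, so that $\beta\wedge\phi=\beta\cdot\phi$ for a $\mathfrak g$-valued function $\beta$. **Statement.** Let $\xi\mapsto\tilde\xi$ be a linear lift, $\tilde\omega$ a connection on $P$ and $\xi$ a smooth vector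 field on $X$. Then $\tilde\lambda_\xi:=\iota_{\tilde\xi}\tilde\omega$ is a smooth $G$-equivariant $\mathfrak g$-valued function on $P$, and so corresponds to a section $\lambda_\xi\in\Omega^0(X;P\times_G\mathfrak g)$, with local representatives $\lambda_{\xi,\sigma}=\sigma^*\tilde\lambda_\xi$. Moreover: 1. For every $p\ge 0$ and every $\phi\in\Omega^p(X;V_G)$ with corresponding form $\tilde\phi$ on $P$, the form $L_{\tilde\xi}\tilde\phi$ is smooth, horizontal and $G$-equivariant, and so corresponds to a form $\tilde L_\xi\phi\in\Omega^p(X;V_G)$, the covariant Lie derivative of $\phi$, with $(\tilde L_\xi\phi)_\sigma=\sigma^*(L_{\tilde\xi}\tilde\phi)$. With respect to every local section, $$\tilde L_\xi\phi=\iota_\xi d^\omega\phi+d^\omega(\iota_\xi\phi)-\lambda_\xi\wedge\phi=L_\xi\phi+(\iota_\xi\omega-\lambda_\xi)\wedge\phi .$$ 2. The form $L_{\tilde\xi}\tilde\omega$ is smooth, horizontal and $G$-equivariant, and so corresponds to a form $\tilde L_\xi\omega\in\Omega^1(X;P\times_G\mathfrak g)$, the covariant Lie derivative of $\omega$, with $(\tilde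 L_\xi\omega)_\sigma=\sigma^*(L_{\tilde\xi}\tilde\omega)$. With respect to every local section, $$\tilde L_\xi\omega=\iota_\xi F_\omega+d^\omega\lambda_\xi=L_\xi\omega-d^\omega(\iota_\xi\omega-\lambda_\xi).$$ -/

import Mathlib

open Set
open scoped Manifold ContDiff Topology

noncomputable section

namespace CovLie

/-! ### Differential forms on smooth manifolds

All manifolds are real, without boundary, modelled on a normed space `E`.  In Mathlib the tangent
space `TangentSpace 𝓘(ℝ, E) x` *is* the vector space `E` (read in the preferred chart at `x`), so
an alternating form on `T_x M` is an alternating form on `E`. -/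

section Forms

/-- `V`-valued differential `p`-forms on `M` (not necessarily smooth): an alternating `p`-linear
map `T_x M × ⋯ × T_x M → V` for every `x`. -/
abbrev Form (E : Type*) [NormedAddCommGroup E] [NormedSpace ℝ E] (M : Type*) (p : ℕ)
    (V : Type*) [NormedAddCommGroup V] [NormedSpace ℝ V] : Type _ :=
  M → E [⋀^Fin p]→L[ℝ] V

/-- Smooth vector fields on `M`, with their real vector space structure. -/
abbrev VecField (E : Type*) [NormedAddCommGroup E] [NormedSpace ℝ E] (M : Type*)
    [TopologicalSpace M] [ChartedSpace E M] [IsManifold 𝓘(ℝ, E) ∞ M] : Type _ :=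
  ContMDiffSection 𝓘(ℝ, E) E ∞ (TangentSpace 𝓘(ℝ, E) : M → Type _)

variable {E : Type*} [NormedAddCommGroup E] [NormedSpace ℝ E]
  {M : Type*} [TopologicalSpace M] [ChartedSpace E M]
  {E' : Type*} [NormedAddCommGroup E'] [NormedSpace ℝ E']
  {N : Type*} [TopologicalSpace N] [ChartedSpace E' N]
  {V : Type*} [NormedAddCommGroup V] [NormedSpace ℝ V]
  {W : Type*} [NormedAddCommGroup W] [NormedSpace ℝ W]
  {p : ℕ}

/-- The tangent map `T_x f : T_x M → T_{f x} N`. -/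
def tmap (f : M → N) (x : M) : E →L[ℝ] E' := mfderiv 𝓘(ℝ, E) 𝓘(ℝ, E') f x

/-- The value at `x` of a vector field. -/
def VecField.val [IsManifold 𝓘(ℝ, E) ∞ M] (Z : VecField E M) (x : M) : E := Z x

/-- The pullback `f^* θ`. -/
def pullback (f : M → N) (θ : Form E' N p V) : Form E M p V :=
  fun x => (θ (f x)).compContinuousLinearMap (tmap f x)

/-- The coordinate representation of `θ` in the chart around `x₀`, i.e. the pullback of `θ` by the
inverse of the chart; meaningful on the target of the chart, which is an open subset of `E`. -/
def chartRep (x₀ : M) (θ : Form E M p V) : E → E [⋀^Fin p]→L[ℝ] V :=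
  pullback (extChartAt 𝓘(ℝ, E) x₀).symm θ

/-- `θ` is smooth on the (open) set `U`: its coordinate representations are. -/
def SmoothFormOn (θ : Form E M p V) (U : Set M) : Prop :=
  ∀ x₀ : M, ContDiffOn ℝ ∞ (chartRep x₀ θ)
    ((extChartAt 𝓘(ℝ, E) x₀).target ∩ (extChartAt 𝓘(ℝ, E) x₀).symm ⁻¹' U)

/-- The exterior derivative `dθ`: at `x`, the exterior derivative in the chart around `x`.
No factor `1 / (p + 1)` occurs, so `dθ(X, Y) = X(θ Y) - Y(θ X) - θ([X, Y])` on `1`-forms. -/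
def extD (θ : Form E M p V) : Form E M (p + 1) V :=
  fun x => (extDeriv (chartRep x θ) (extChartAt 𝓘(ℝ, E) x x)).compContinuousLinearMap
    (tmap (extChartAt 𝓘(ℝ, E) x) x)

/-- The interior product `ι_Z θ` of a form of positive degree (`Z` is plugged in first). -/
def iprod (Z : M → E) (θ : Form E M (p + 1) V) : Form E M p V :=
  fun x => (θ x).curryLeft (Z x)

/-- The Lie derivative `L_Z θ = d ι_Z θ + ι_Z d θ`; on `0`-forms `ι_Z θ = 0`. -/
def lieD (Z : M → E) : {p : ℕ} → Form E M p V → Form E M p V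
  | 0, θ => iprod Z (extD θ)
  | _ + 1, θ => extD (iprod Z θ) + iprod Z (extD θ)

/-- The wedge product `α ∧ θ` of a `W`-valued `1`-form and a `V`-valued `p`-form with respect to a
bilinear map `a : W × V → V`; see `wedge_apply` for the formula. -/
def wedge (a : W →L[ℝ] V →L[ℝ] V) (α : Form E M 1 W) (θ : Form E M p V) : Form E M (p + 1) V :=
  fun x => ContinuousAlternatingMap.alternatizeUncurryFin
    (((ContinuousLinearMap.compContinuousAlternatingMapCLM ℝ E V V (Fin p)).flip (θ x)).comp
      (a.comp ((ContinuousAlternatingMap.ofSubsingleton ℝ E W (0 : Fin 1)).symm (α x))))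

/-- The wedge product `l ∧ θ` of a `W`-valued `0`-form and a `V`-valued `p`-form with respect to a
bilinear map `a : W × V → V`. -/
def wedgeZero (a : W →L[ℝ] V →L[ℝ] V) (l : Form E M 0 W) (θ : Form E M p V) : Form E M p V :=
  fun x => (a (l x ![])).compContinuousAlternatingMap (θ x)

/-- The covariant derivative `d^α θ = dθ + α ∧ θ`. -/
def covD (a : W →L[ℝ] V →L[ℝ] V) (α : Form E M 1 W) (θ : Form E M p V) : Form E M (p + 1) V :=
  extD θ + wedge a α θ

/-- `d^α (ι_Z θ)`, as a form of the same degree as `θ`; on `0`-forms `ι_Z θ = 0`. -/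
def covDInterior (a : W →L[ℝ] V →L[ℝ] V) (α : Form E M 1 W) (Z : M → E) :
    {p : ℕ} → Form E M p V → Form E M p V
  | 0, _ => 0
  | _ + 1, θ => covD a α (iprod Z θ)

theorem wedge_apply {M : Type*} (a : W →L[ℝ] V →L[ℝ] V) (α : Form E M 1 W) (θ : Form E M p V) (x : M)
    (v : Fin (p + 1) → E) :
    wedge a α θ x v = ∑ i : Fin (p + 1), (-1 : ℤ) ^ (i : ℕ) • a (α x ![v i]) (θ x (i.removeNth v)) := by
  simp only [wedge, ContinuousAlternatingMap.alternatizeUncurryFin_apply]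
  refine Finset.sum_congr rfl fun i _ => ?_
  have h : (fun _ : Fin 1 => v i) = ![v i] := by ext j; simp
  rw [← h]
  rfl

end Forms

/-! ### The Lie algebra of a Lie group and its representations -/

section LieGroups

variable {EG : Type*} [NormedAddCommGroup EG] [NormedSpace ℝ EG] [FiniteDimensional ℝ EG]
  {G : Type*} [TopologicalSpace G] [ChartedSpace EG G] [Group G]

/-- The Lie bracket of `𝔤 = T_1 G` (whose underlying vector space is `EG`), the bracket of
left-invariant vector fields, as a continuous bilinear map. -/
def lieBr (EG : Type*) [NormedAddCommGroup EG] [NormedSpace ℝ EG] [FiniteDimensional ℝ EG]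
    (G : Type*) [TopologicalSpace G] [ChartedSpace EG G] [Group G] [LieGroup 𝓘(ℝ, EG) ∞ G] :
    EG →L[ℝ] EG →L[ℝ] EG :=
  haveI : LieGroup 𝓘(ℝ, EG) (minSmoothness ℝ 3) G := 
    LieGroup.of_le (n := ∞) (by simp only [minSmoothness_of_isRCLikeNormedField]; exact ENat.LEInfty.out)
  haveI : CompleteSpace EG := FiniteDimensional.complete ℝ EG
  LinearMap.toContinuousBilinearMap
    (LinearMap.mk₂ ℝ
      (fun A B : GroupLieAlgebra 𝓘(ℝ, EG) G => (⁅A, B⁆ : GroupLieAlgebra 𝓘(ℝ, EG) G))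
      (fun A B C : GroupLieAlgebra 𝓘(ℝ, EG) G => add_lie A B C)
      (fun (c : ℝ) (A B : GroupLieAlgebra 𝓘(ℝ, EG) G) => smul_lie c A B)
      (fun A B C : GroupLieAlgebra 𝓘(ℝ, EG) G => lie_add A B C)
      (fun (c : ℝ) (A B : GroupLieAlgebra 𝓘(ℝ, EG) G) => lie_smul c A B))

/-- The adjoint representation `Ad g : 𝔤 → 𝔤`, the derivative at `1` of `h ↦ g h g⁻¹`. -/
def Ad (g : G) : EG →L[ℝ] EG := tmap (fun h : G => g * h * g⁻¹) 1

/-- A smooth representation of the Lie group `G` on `V`. -/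
structure SmoothRep (EG : Type*) [NormedAddCommGroup EG] [NormedSpace ℝ EG]
    (G : Type*) [TopologicalSpace G] [ChartedSpace EG G] [Group G]
    (V : Type*) [NormedAddCommGroup V] [NormedSpace ℝ V] where
  toHom : G →* (V →L[ℝ] V)
  smooth : ContMDiff 𝓘(ℝ, EG) 𝓘(ℝ, V →L[ℝ] V) ∞ toHom

/-- The derived representation `𝔤 → End V`. -/
def SmoothRep.derived {V : Type*} [NormedAddCommGroup V] [NormedSpace ℝ V]
    (r : SmoothRep EG G V) : EG →L[ℝ] V →L[ℝ] V := tmap (fun g => r.toHom g) (1 : G)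

end LieGroups

/-- The curvature `F_α = dα + ½ [α ∧ α]` of a `𝔤`-valued `1`-form. -/
def curvature {EG : Type*} [NormedAddCommGroup EG] [NormedSpace ℝ EG] [FiniteDimensional ℝ EG]
    (G : Type*) [TopologicalSpace G] [ChartedSpace EG G] [Group G] [LieGroup 𝓘(ℝ, EG) ∞ G]
    {E : Type*} [NormedAddCommGroup E] [NormedSpace ℝ E]
    {M : Type*} [TopologicalSpace M] [ChartedSpace E M]
    (α : Form E M 1 EG) : Form E M 2 EG :=
  extD α + (1 / 2 : ℝ) • wedge (lieBr EG G) α α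

/-! ### Principal bundles, connections and associated forms -/

/-- A smooth principal `G`-bundle `proj : P → X` with right action `act : P × G → P`. -/
structure PrincipalBundle (EX X EG G EP P : Type*)
    [NormedAddCommGroup EX] [NormedSpace ℝ EX] [TopologicalSpace X] [ChartedSpace EX X]
    [NormedAddCommGroup EG] [NormedSpace ℝ EG] [TopologicalSpace G] [ChartedSpace EG G] [Group G]
    [NormedAddCommGroup EP] [NormedSpace ℝ EP] [TopologicalSpace P] [ChartedSpace EP P] where
  proj : P → X
  act : P → G → P
  proj_smooth : ContMDiff 𝓘(ℝ, EP) 𝓘(ℝ, EX) ∞ proj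
  act_smooth : ContMDiff (𝓘(ℝ, EP).prod 𝓘(ℝ, EG)) 𝓘(ℝ, EP) ∞ (fun q : P × G => act q.1 q.2)
  act_one : ∀ u, act u 1 = u
  act_mul : ∀ u g h, act (act u g) h = act u (g * h)
  proj_act : ∀ u g, proj (act u g) = proj u
  /-- Local triviality: `P|_U ≅ U × G`, smoothly and `G`-equivariantly over `U`. -/
  locally_trivial : ∀ x : X, ∃ (U : Set X) (e : OpenPartialHomeomorph P (X × G)),
    IsOpen U ∧ x ∈ U ∧ e.source = proj ⁻¹' U ∧ e.target = U ×ˢ univ ∧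
    ContMDiffOn 𝓘(ℝ, EP) (𝓘(ℝ, EX).prod 𝓘(ℝ, EG)) ∞ e e.source ∧
    ContMDiffOn (𝓘(ℝ, EX).prod 𝓘(ℝ, EG)) 𝓘(ℝ, EP) ∞ e.symm e.target ∧
    (∀ u ∈ e.source, (e u).1 = proj u) ∧
    (∀ u ∈ e.source, ∀ g, e (act u g) = ((e u).1, (e u).2 * g))

section Bundle

variable {EX : Type*} [NormedAddCommGroup EX] [NormedSpace ℝ EX] [FiniteDimensional ℝ EX]
  {X : Type*} [TopologicalSpace X] [ChartedSpace EX X]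
  {EG : Type*} [NormedAddCommGroup EG] [NormedSpace ℝ EG] [FiniteDimensional ℝ EG]
  {G : Type*} [TopologicalSpace G] [ChartedSpace EG G] [Group G]
  {EP : Type*} [NormedAddCommGroup EP] [NormedSpace ℝ EP] [FiniteDimensional ℝ EP]
  {P : Type*} [TopologicalSpace P] [ChartedSpace EP P]
  {V : Type*} [NormedAddCommGroup V] [NormedSpace ℝ V] {p : ℕ}

namespace PrincipalBundle

/-- A smooth local section `σ : U → P` over an open set `U = dom` (equivalently, a local
trivialization of `P` over `U`).  The values of `σ` outside `U` are irrelevant. -/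
structure LocalSection (B : PrincipalBundle EX X EG G EP P) where
  dom : Set X
  isOpen_dom : IsOpen dom
  toFun : X → P
  smooth : ContMDiffOn 𝓘(ℝ, EX) 𝓘(ℝ, EP) ∞ toFun dom
  proj_toFun : ∀ x ∈ dom, B.proj (toFun x) = x

variable (B : PrincipalBundle EX X EG G EP P)

/-- The fundamental vector field `A^#` of `A ∈ 𝔤`, `A^#(u) = d/dt u · exp(tA)` at `t = 0`. -/
def fundamental (A : EG) (u : P) : EP := tmap (fun g : G => B.act u g) 1 A

/-- A connection on `P`: a smooth `G`-equivariant `𝔤`-valued `1`-form with `ω(A^#) = A`. -/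
structure Connection where
  form : Form EP P 1 EG
  smooth : SmoothFormOn form univ
  equivariant : ∀ (g : G) (u : P),
    pullback (fun u => B.act u g) form u = (Ad g⁻¹).compContinuousAlternatingMap (form u)
  fundamental : ∀ (A : EG) (u : P), form u ![B.fundamental A u] = A

/-- An `ℝ`-linear lift of vector fields on `X` to `G`-invariant vector fields on `P`. -/
structure InvariantLift [IsManifold 𝓘(ℝ, EX) ∞ X] [IsManifold 𝓘(ℝ, EP) ∞ P] where
  lift : VecField EX X →ₗ[ℝ] VecField EP P
  proj_lift : ∀ (ξ : VecField EX X) (u : P),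
    tmap B.proj u ((lift ξ).val u) = ξ.val (B.proj u)
  invariant : ∀ (ξ : VecField EX X) (g : G) (u : P),
    tmap (fun u => B.act u g) u ((lift ξ).val u) = (lift ξ).val (B.act u g)

/-- Smooth, horizontal and `G`-equivariant `V`-valued forms on `P`, where `G` acts on `V` by `a`. -/
structure IsTensorial (a : G → V →L[ℝ] V) (Θ : Form EP P p V) : Prop where
  smooth : SmoothFormOn Θ univ
  horizontal : ∀ (u : P) (v : Fin p → EP), (∃ i, tmap (E' := EX) B.proj u (v i) = 0) → Θ u v = 0
  equivariant : ∀ (g : G) (u : P),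
    pullback (fun u => B.act u g) Θ u = (a g⁻¹).compContinuousAlternatingMap (Θ u)

/-- A family of `V`-valued `p`-forms, one for every local section `σ`; only the values on the
domain of `σ` are relevant. -/
abbrev LocalFamily {EX X EG G EP P : Type*}
    [NormedAddCommGroup EX] [NormedSpace ℝ EX] [TopologicalSpace X] [ChartedSpace EX X]
    [NormedAddCommGroup EG] [NormedSpace ℝ EG] [TopologicalSpace G] [ChartedSpace EG G] [Group G]
    [NormedAddCommGroup EP] [NormedSpace ℝ EP] [TopologicalSpace P] [ChartedSpace EP P]
    (B : PrincipalBundle EX X EG G EP P) (p : ℕ)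
    (V : Type*) [NormedAddCommGroup V] [NormedSpace ℝ V] : Type _ :=
  B.LocalSection → Form EX X p V

/-- `φ` is (the family of local representatives of) a smooth `p`-form on `X` with values in the
associated bundle `P ×_G V`, where `G` acts on `V` by `a`: if `τ = σ · γ` then
`φ_τ = γ⁻¹ · φ_σ`. -/
structure IsAssociatedForm (a : G → V →L[ℝ] V) (φ : B.LocalFamily p V) : Prop where
  smooth : ∀ σ : B.LocalSection, SmoothFormOn (φ σ) σ.dom
  compat : ∀ (σ τ : B.LocalSection) (x : X), x ∈ σ.dom → x ∈ τ.dom →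
    ∀ g : G, τ.toFun x = B.act (σ.toFun x) g →
      φ τ x = (a g⁻¹).compContinuousAlternatingMap (φ σ x)

/-- The local representatives `σ^* Θ` of a form on `P`. -/
def localReps (Θ : Form EP P p V) : B.LocalFamily p V :=
  fun σ => pullback σ.toFun Θ

open Classical in
/-- The form on `P` corresponding to an associated form `φ` on `X`: at `u` it is the pullback
along `T_u proj` of `φ_σ`, for any local section `σ` through `u`. -/
def totalForm (φ : B.LocalFamily p V) : Form EP P p V := fun u =>
  if h : ∃ σ : B.LocalSection, B.proj u ∈ σ.dom ∧ σ.toFun (B.proj u) = u then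
    (φ h.choose (B.proj u)).compContinuousLinearMap (tmap B.proj u)
  else 0

/-- The correspondence between forms `φ` on `X` with values in `P ×_G V` and smooth horizontal
`G`-equivariant forms `Θ` on `P`: the local representatives of `φ` are the pullbacks `σ^* Θ`. -/
def Corresponds (a : G → V →L[ℝ] V) (φ : B.LocalFamily p V) (Θ : Form EP P p V) : Prop :=
  B.IsAssociatedForm a φ ∧ B.IsTensorial a Θ ∧
    ∀ σ : B.LocalSection, ∀ x ∈ σ.dom, φ σ x = B.localReps Θ σ x

variable {B} [IsManifold 𝓘(ℝ, EX) ∞ X] [IsManifold 𝓘(ℝ, EP) ∞ P]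

/-- The covariant Lie derivative of an associated form `φ` on `X` along `ξ`: the local
representatives of the Lie derivative of the corresponding form on `P` along the lift of `ξ`. -/
def InvariantLift.covLieForm (L : B.InvariantLift) (ξ : VecField EX X)
    (φ : B.LocalFamily p V) : B.LocalFamily p V :=
  B.localReps (lieD (L.lift ξ).val (B.totalForm φ))

/-- The covariant Lie derivative of (the gauge field on `X` of) a connection along `ξ`: the local
representatives of the Lie derivative of the connection form along the lift of `ξ`. -/
def InvariantLift.covLieConnection (L : B.InvariantLift) (ξ : VecField EX X)
    (w : B.Connection) : LocalFamily B 1 EG :=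
  B.localReps (lieD (L.lift ξ).val w.form)

/-- `λ̃_ξ = ι_{ξ̃} ω̃`, a `𝔤`-valued function on `P`. -/
def InvariantLift.lamTotal (L : B.InvariantLift) (w : B.Connection) (ξ : VecField EX X) :
    Form EP P 0 EG :=
  iprod (L.lift ξ).val w.form

end PrincipalBundle

end Bundle

end CovLie

end

/-! Everything rests on one algebraic fact: Cartan's formula absorbs an arbitrary 1-form `α`. Since
`ι_Z (α ∧ θ) = (ι_Z α) θ - α ∧ ι_Z θ`, replacing `d` by `d^α` in both summands of `L_Z θ` changes
the result exactly by `(ι_Z α) θ` (`lieD_eq_covD`). For a skew bracket the same computation gives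
`L_Z α = ι_Z F_α + d^α (ι_Z α)` (`lieD_one_form`). On `P`, with the connection as `α` and the lift
as `Z`, these are the asserted formulas before descent. On `X`, with `Z = ξ`, they convert the first
local formula into the second.

To descend, each term must be horizontal. Differentiating equivariance gives `L_{A^#} Θ = -A · Θ`
(`lieD_fundamental`). Inserted into the same two identities with `Z = A^#`, this yields `ι_{A^#} d^ω
Θ = 0` and `ι_{A^#} F_ω = 0`; as fundamental vectors exhaust the vertical ones, `d^ω Θ` and `F_ω`
are horizontal. For the curvature one also needs that the derivative of `Ad` at `1` is the Lie
bracket (`tmap_Ad`). On a horizontal form, pullback by a section `σ` turns contraction with the lift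
into contraction with `ξ`, because the lift and `dσ(ξ)` differ by a vertical vector; `d` commutes
with pullback (`extD_pullback`). Equivariance of the Lie derivative follows from naturality of `d`
and `ι` under the action and invariance of the lift.

No flow or exponential map is used: `A^#` is handled through the map `(t, y) ↦ y · c(t)`, where `c`
is a straight line in the chart of `G` at `1`, since only its velocity at `0` enters. -/

noncomputable section
set_option linter.unusedSectionVars false

namespace CovLie

/-! ### Smooth dependence of alternating maps on parameters -/

section AlternatingCalculus

variable {E : Type*} [NormedAddCommGroup E] [NormedSpace ℝ E]
  {E' : Type*} [NormedAddCommGroup E'] [NormedSpace ℝ E']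
  {V : Type*} [NormedAddCommGroup V] [NormedSpace ℝ V]
  {H : Type*} [NormedAddCommGroup H] [NormedSpace ℝ H]
  {ι : Type*} [Fintype ι] {n : WithTop ℕ∞}

/-- Antisymmetrization, as a continuous linear map. -/
def alternatizationCLM (E V ι : Type*) [NormedAddCommGroup E] [NormedSpace ℝ E]
    [NormedAddCommGroup V] [NormedSpace ℝ V] [Fintype ι] [DecidableEq ι] :
    ContinuousMultilinearMap ℝ (fun _ : ι => E) V →L[ℝ] E [⋀^ι]→L[ℝ] V :=
  LinearMap.mkContinuous
    { toFun := ContinuousMultilinearMap.alternatization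
      map_add' := map_add _
      map_smul' := fun c f => by
        ext v
        simp [ContinuousMultilinearMap.alternatization_apply_apply, Finset.smul_sum,
          smul_comm c] }
    (Fintype.card (Equiv.Perm ι)) (fun f => by
      refine ContinuousAlternatingMap.opNorm_le_bound _ (by positivity) fun m => ?_
      simp only [LinearMap.coe_mk, AddHom.coe_mk,
        ContinuousMultilinearMap.alternatization_apply_apply]
      refine (norm_sum_le_of_le (f := _) (n := fun _ => ‖f‖ * ∏ i, ‖m i‖) _ fun σ _ => ?_).trans ?_
      · have h : ‖f (m ∘ σ)‖ ≤ ‖f‖ * ∏ i, ‖m i‖ := by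
          refine (f.le_opNorm _).trans_eq ?_
          congr 1
          exact Equiv.prod_comp σ (fun i => ‖m i‖)
        rcases Int.units_eq_one_or (Equiv.Perm.sign σ) with hs | hs <;> simpa [hs] using h
      · simp [mul_assoc])

theorem alternatizationCLM_toContinuousMultilinearMap [DecidableEq ι] (f : E [⋀^ι]→L[ℝ] V) :
    alternatizationCLM E V ι f.toContinuousMultilinearMap = ((Fintype.card ι).factorial : ℝ) • f := by
  have h := AlternatingMap.coe_alternatization f.toAlternatingMap
  ext v
  have h' := congrArg (fun g => g v) h
  simpa [alternatizationCLM, ContinuousMultilinearMap.alternatization_apply_apply,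
    MultilinearMap.alternatization_apply, Nat.cast_smul_eq_nsmul, Function.comp_def] using h'

/-- Antisymmetrization divided by the factorial of the number of slots is a continuous linear left
inverse of the inclusion into multilinear maps. Smoothness questions therefore reduce to the
multilinear case, where composition is already known to be smooth. -/
theorem contDiffAt_toContinuousMultilinearMap_iff {f : H → E [⋀^ι]→L[ℝ] V} {x : H} :
    ContDiffAt ℝ n (fun y => (f y).toContinuousMultilinearMap) x ↔ ContDiffAt ℝ n f x := by
  classical
  refine ⟨fun h => ?_, fun h =>
    ((ContinuousAlternatingMap.toContinuousMultilinearMapCLM ℝ :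
      (E [⋀^ι]→L[ℝ] V) →L[ℝ] _).contDiff.contDiffAt (n := n)).comp x h⟩
  have h1 := ((alternatizationCLM E V ι).contDiff.contDiffAt.comp x h).const_smul
    ((Fintype.card ι).factorial : ℝ)⁻¹
  refine h1.congr_of_eventuallyEq (Filter.Eventually.of_forall fun y => ?_)
  simp [alternatizationCLM_toContinuousMultilinearMap, smul_smul,
    inv_mul_cancel₀ (Nat.cast_ne_zero (R := ℝ).2 (Nat.factorial_ne_zero _))]

theorem _root_.ContDiffAt.continuousAlternatingMap_compContinuousLinearMap
    {f : H → E' [⋀^ι]→L[ℝ] V} {g : H → E →L[ℝ] E'} {x : H}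
    (hf : ContDiffAt ℝ n f x) (hg : ContDiffAt ℝ n g x) :
    ContDiffAt ℝ n (fun y => (f y).compContinuousLinearMap (g y)) x := by
  rw [← contDiffAt_toContinuousMultilinearMap_iff] at hf ⊢
  have h := (ContinuousMultilinearMap.compContinuousLinearMapContinuousMultilinear ℝ
    (fun _ : ι => E) (fun _ => E') V).contDiff (n := n)
  have h2 : ContDiffAt ℝ n (fun y => fun _ : ι => g y) x := contDiffAt_pi.2 fun _ => hg
  exact (h.contDiffAt.comp x h2).clm_apply hf

theorem _root_.ContDiffAt.compContinuousAlternatingMap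
    {W : Type*} [NormedAddCommGroup W] [NormedSpace ℝ W]
    {f : H → E [⋀^ι]→L[ℝ] V} {g : H → V →L[ℝ] W} {x : H}
    (hg : ContDiffAt ℝ n g x) (hf : ContDiffAt ℝ n f x) :
    ContDiffAt ℝ n (fun y => (g y).compContinuousAlternatingMap (f y)) x := by
  rw [← contDiffAt_toContinuousMultilinearMap_iff] at hf ⊢
  exact (((ContinuousLinearMap.compContinuousMultilinearMapL ℝ (fun _ : ι => E) V W).contDiff.contDiffAt
    (n := n)).comp x hg).clm_apply hf

end AlternatingCalculus

/-! ### Tangent maps and charts -/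

section Tangent
variable {E : Type*} [NormedAddCommGroup E] [NormedSpace ℝ E]
  {M : Type*} [TopologicalSpace M] [ChartedSpace E M]
  {E' : Type*} [NormedAddCommGroup E'] [NormedSpace ℝ E']
  {N : Type*} [TopologicalSpace N] [ChartedSpace E' N]
  {E'' : Type*} [NormedAddCommGroup E''] [NormedSpace ℝ E'']
  {N' : Type*} [TopologicalSpace N'] [ChartedSpace E'' N']

theorem tmap_comp {g : N → N'} {f : M → N} {x : M} (hg : MDifferentiableAt 𝓘(ℝ, E') 𝓘(ℝ, E'') g (f x))
    (hf : MDifferentiableAt 𝓘(ℝ, E) 𝓘(ℝ, E') f x) :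
    tmap (E := E) (E' := E'') (g ∘ f) x = (tmap g (f x)).comp (tmap (E := E) (E' := E') f x) :=
  mfderiv_comp x hg hf

theorem tmap_congr {f g : M → N} {x : M} (h : f =ᶠ[𝓝 x] g) :
    tmap (E := E) (E' := E') f x = tmap g x :=
  h.mfderiv_eq

theorem tmap_eq_fderiv (f : E → E') (x : E) : tmap f x = fderiv ℝ f x := mfderiv_eq_fderiv

theorem tmap_id (x : M) : tmap (E := E) (E' := E) (fun y : M => y) x = ContinuousLinearMap.id ℝ E :=
  mfderiv_id

theorem tmap_const (c : N) (x : M) : tmap (E := E) (E' := E') (fun _ : M => c) x = 0 :=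
  mfderiv_const

variable [IsManifold 𝓘(ℝ, E) ∞ M] [IsManifold 𝓘(ℝ, E') ∞ N]

theorem tmap_extChartAt_self (x : M) :
    tmap (E := E) (E' := E) (extChartAt 𝓘(ℝ, E) x) x = ContinuousLinearMap.id ℝ E :=
  mfderiv_extChartAt_self

theorem contMDiffAt_extChartAt_symm {n : WithTop ℕ∞} [IsManifold 𝓘(ℝ, E) n M] {x : M} {y : E}
    (hy : y ∈ (extChartAt 𝓘(ℝ, E) x).target) :
    ContMDiffAt 𝓘(ℝ, E) 𝓘(ℝ, E) n (extChartAt 𝓘(ℝ, E) x).symm y :=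
  (contMDiffOn_extChartAt_symm x).contMDiffAt ((isOpen_extChartAt_target x).mem_nhds hy)

theorem eventually_mem_target (x : M) :
    ∀ᶠ y in 𝓝 (extChartAt 𝓘(ℝ, E) x x), y ∈ (extChartAt 𝓘(ℝ, E) x).target :=
  extChartAt_target_mem_nhds x

theorem tendsto_extChartAt_symm (x : M) :
    Filter.Tendsto (extChartAt 𝓘(ℝ, E) x).symm (𝓝 (extChartAt 𝓘(ℝ, E) x x)) (𝓝 x) := by
  have h := continuousAt_extChartAt_symm (I := 𝓘(ℝ, E)) x
  rwa [ContinuousAt, extChartAt_to_inv] at h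

theorem eventually_contMDiffAt {f : M → N} {x : M} (hf : ContMDiffAt 𝓘(ℝ, E) 𝓘(ℝ, E') ∞ f x) :
    ∀ᶠ y in 𝓝 x, ContMDiffAt 𝓘(ℝ, E) 𝓘(ℝ, E') 1 f y :=
  (contMDiffAt_iff_contMDiffAt_nhds (by simp)).1 (hf.of_le (by simp))

end Tangent

/-! ### Pullback, smoothness and exterior derivative of forms -/

section FormCalculus
variable {E : Type*} [NormedAddCommGroup E] [NormedSpace ℝ E]
  {M : Type*} [TopologicalSpace M] [ChartedSpace E M] [IsManifold 𝓘(ℝ, E) ∞ M]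
  {E' : Type*} [NormedAddCommGroup E'] [NormedSpace ℝ E']
  {N : Type*} [TopologicalSpace N] [ChartedSpace E' N] [IsManifold 𝓘(ℝ, E') ∞ N]
  {E'' : Type*} [NormedAddCommGroup E''] [NormedSpace ℝ E'']
  {N' : Type*} [TopologicalSpace N'] [ChartedSpace E'' N']
  {V : Type*} [NormedAddCommGroup V] [NormedSpace ℝ V]
  {W : Type*} [NormedAddCommGroup W] [NormedSpace ℝ W]
  {p : ℕ}

omit [IsManifold 𝓘(ℝ, E) ∞ M] [IsManifold 𝓘(ℝ, E') ∞ N] in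
theorem pullback_apply (f : M → N) (θ : Form E' N p V) (x : M) (v : Fin p → E) :
    pullback f θ x v = θ (f x) (fun i => tmap (E := E) f x (v i)) := rfl

theorem pullback_comp {g : N → N'} {f : M → N} {x : M} (θ : Form E'' N' p V)
    (hg : MDifferentiableAt 𝓘(ℝ, E') 𝓘(ℝ, E'') g (f x))
    (hf : MDifferentiableAt 𝓘(ℝ, E) 𝓘(ℝ, E') f x) :
    pullback (E := E) (g ∘ f) θ x = pullback f (pullback (E := E') g θ) x := by
  ext v
  simp only [pullback_apply, tmap_comp hg hf]
  rfl

theorem pullback_congr_map {f g : M → N} {x : M} (h : f =ᶠ[𝓝 x] g) (θ : Form E' N p V) :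
    pullback (E := E) f θ x = pullback g θ x := by
  simp only [pullback, tmap_congr h, h.eq_of_nhds]

theorem chartRep_congr {x : M} {θ θ' : Form E M p V} (h : θ =ᶠ[𝓝 x] θ') :
    chartRep x θ =ᶠ[𝓝 (extChartAt 𝓘(ℝ, E) x x)] chartRep x θ' := by
  filter_upwards [(tendsto_extChartAt_symm (E := E) x).eventually h] with y hy
  simp only [chartRep, pullback, hy]

theorem chartRep_model (x : E) (θ : Form E E p V) : chartRep x θ = θ := by
  ext y v
  simp only [chartRep, extChartAt_model_space_eq_id, pullback_apply]
  congr 1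
  funext i
  exact congrArg (fun A : E →L[ℝ] E => A (v i)) (tmap_id y)

/-- `f` read in the preferred charts. -/
def inCharts (f : M → N) (x : M) : E → E' :=
  fun y => extChartAt 𝓘(ℝ, E') (f x) (f ((extChartAt 𝓘(ℝ, E) x).symm y))

theorem inCharts_def (f : M → N) (x : M) : inCharts f x =
    fun y : E => extChartAt 𝓘(ℝ, E') (f x) (f ((extChartAt 𝓘(ℝ, E) x).symm y)) := rfl

theorem inCharts_self (f : M → N) (x : M) :
    inCharts f x (extChartAt 𝓘(ℝ, E) x x) = extChartAt 𝓘(ℝ, E') (f x) (f x) := by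
  simp [inCharts]

theorem contDiffAt_inCharts {f : M → N} {x : M} {n : WithTop ℕ∞}
    (hf : ContMDiffAt 𝓘(ℝ, E) 𝓘(ℝ, E') n f x) :
    ContDiffAt ℝ n (inCharts (E := E) (E' := E') f x) (extChartAt 𝓘(ℝ, E) x x) := by
  have h := (contMDiffAt_iff.1 hf).2
  simpa [contDiffWithinAt_univ, Function.comp_def, inCharts_def] using h

/-- Pullback commutes with passing to coordinates. -/
theorem chartRep_pullback {f : M → N} {x : M} (hf : ContMDiffAt 𝓘(ℝ, E) 𝓘(ℝ, E') ∞ f x)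
    (θ : Form E' N p V) :
    chartRep (E := E) x (pullback f θ) =ᶠ[𝓝 (extChartAt 𝓘(ℝ, E) x x)]
      fun y => (chartRep (f x) θ (inCharts f x y)).compContinuousLinearMap
        (fderiv ℝ (inCharts f x) y) := by
  have hs : ∀ᶠ z in 𝓝 x, f z ∈ (chartAt E' (f x)).source :=
    hf.continuousAt.eventually ((chartAt E' (f x)).open_source.mem_nhds (mem_chart_source E' (f x)))
  have hz := (eventually_contMDiffAt hf).and hs.eventually_nhds
  filter_upwards [(tendsto_extChartAt_symm (E := E) x).eventually hz,
    eventually_mem_target (E := E) x] with y hy hyt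
  obtain ⟨hfy, hsy⟩ := hy
  have hsym := (contMDiffAt_extChartAt_symm (n := 1) hyt).mdifferentiableAt one_ne_zero
  have hfd := hfy.mdifferentiableAt one_ne_zero
  have hch : MDifferentiableAt 𝓘(ℝ, E') 𝓘(ℝ, E') (extChartAt 𝓘(ℝ, E') (f x))
      (f ((extChartAt 𝓘(ℝ, E) x).symm y)) :=
    (contMDiffAt_extChartAt' (n := 1) hsy.self_of_nhds).mdifferentiableAt one_ne_zero
  have hin : MDifferentiableAt 𝓘(ℝ, E) 𝓘(ℝ, E') (inCharts (E := E) (E' := E') f x) y :=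
    (hch.comp _ hfd).comp y hsym
  have htgt : inCharts (E := E) (E' := E') f x y ∈ (extChartAt 𝓘(ℝ, E') (f x)).target :=
    (extChartAt 𝓘(ℝ, E') (f x)).map_source (by simpa using hsy.self_of_nhds)
  have hsym' := (contMDiffAt_extChartAt_symm (n := 1) htgt).mdifferentiableAt one_ne_zero
  -- Going through the chart at `f x` and back is the identity as long as `f` stays in its source,
  -- so two factorizations of one map are compared.
  have key : (extChartAt 𝓘(ℝ, E') (f x)).symm ∘ inCharts (E := E) f x =ᶠ[𝓝 y]
      f ∘ (extChartAt 𝓘(ℝ, E) x).symm := by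
    filter_upwards [hsym.continuousAt.eventually hsy] with z hz
    exact (extChartAt 𝓘(ℝ, E') (f x)).left_inv (by simpa using hz)
  have h1 := pullback_comp θ hfd hsym
  have h2 := pullback_comp θ hsym' hin
  rw [pullback_congr_map key] at h2
  rw [chartRep, ← h1, h2]
  simp only [chartRep, ← tmap_eq_fderiv]
  rfl

/-- Smoothness of a form at a point. -/
def SmoothFormAt (θ : Form E M p V) (x : M) : Prop :=
  ContDiffAt ℝ ∞ (chartRep x θ) (extChartAt 𝓘(ℝ, E) x x)

theorem SmoothFormAt.congr {θ θ' : Form E M p V} {x : M} (h : SmoothFormAt θ x)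
    (he : θ' =ᶠ[𝓝 x] θ) : SmoothFormAt θ' x :=
  ContDiffAt.congr_of_eventuallyEq h (chartRep_congr he)

theorem smoothFormAt_model_iff {θ : Form E E p V} {x : E} :
    SmoothFormAt θ x ↔ ContDiffAt ℝ ∞ θ x := by
  rw [SmoothFormAt, chartRep_model, extChartAt_model_space_eq_id]
  rfl

theorem SmoothFormAt.pullback {f : M → N} {x : M} {θ : Form E' N p V} (hθ : SmoothFormAt θ (f x))
    (hf : ContMDiffAt 𝓘(ℝ, E) 𝓘(ℝ, E') ∞ f x) :
    SmoothFormAt (CovLie.pullback (E := E) f θ) x := by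
  refine ContDiffAt.congr_of_eventuallyEq ?_ (chartRep_pullback hf θ)
  have hc := contDiffAt_inCharts hf
  refine ContDiffAt.continuousAlternatingMap_compContinuousLinearMap ?_ (hc.fderiv_right (by simp))
  refine ContDiffAt.comp (g := chartRep (f x) θ) _ ?_ hc
  rw [inCharts_self]
  exact hθ

/-- A chart representation is itself a pullback along an inverse chart, so smoothness tested in the
preferred chart at a point passes to every other chart around it. -/
theorem SmoothFormAt.contDiffAt_chartRep {θ : Form E M p V} {x₀ : M} {y : E}
    (hy : y ∈ (extChartAt 𝓘(ℝ, E) x₀).target)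
    (hθ : SmoothFormAt θ ((extChartAt 𝓘(ℝ, E) x₀).symm y)) :
    ContDiffAt ℝ ∞ (chartRep x₀ θ) y :=
  smoothFormAt_model_iff.1 (hθ.pullback (contMDiffAt_extChartAt_symm hy))

theorem smoothFormOn_iff {θ : Form E M p V} {U : Set M} (hU : IsOpen U) :
    SmoothFormOn θ U ↔ ∀ x ∈ U, SmoothFormAt θ x := by
  constructor
  · intro h x hx
    have ho : IsOpen ((extChartAt 𝓘(ℝ, E) x).target ∩ (extChartAt 𝓘(ℝ, E) x).symm ⁻¹' U) :=
      (continuousOn_extChartAt_symm x).isOpen_inter_preimage (isOpen_extChartAt_target x) hU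
    exact (h x).contDiffAt (ho.mem_nhds ⟨mem_extChartAt_target x, by simpa using hx⟩)
  · intro h x₀ y hy
    exact ((h _ hy.2).contDiffAt_chartRep hy.1).contDiffWithinAt

theorem smoothFormOn_univ_iff {θ : Form E M p V} :
    SmoothFormOn θ univ ↔ ∀ x, SmoothFormAt θ x := by
  simp [smoothFormOn_iff isOpen_univ]

/-! ### Exterior derivative -/

theorem extD_eq (θ : Form E M p V) (x : M) :
    extD θ x = extDeriv (chartRep x θ) (extChartAt 𝓘(ℝ, E) x x) := by
  simp only [extD, tmap_extChartAt_self]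
  rfl

theorem extD_model (θ : Form E E p V) (x : E) : extD θ x = extDeriv θ x := by
  rw [extD_eq, chartRep_model, extChartAt_model_space_eq_id]
  rfl

theorem extD_congr {θ θ' : Form E M p V} {x : M} (h : θ =ᶠ[𝓝 x] θ') : extD θ x = extD θ' x := by
  simp only [extD_eq]
  exact (chartRep_congr h).extDeriv_eq

theorem tmap_eq_fderiv_inCharts {f : M → N} {x : M}
    (hf : MDifferentiableAt 𝓘(ℝ, E) 𝓘(ℝ, E') f x) :
    tmap f x = fderiv ℝ (inCharts (E := E) (E' := E') f x) (extChartAt 𝓘(ℝ, E) x x) := by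
  rw [tmap, hf.mfderiv]
  simp [writtenInExtChartAt, Function.comp_def, inCharts_def, fderivWithin_univ]

theorem two_le_smooth : minSmoothness ℝ 2 ≤ ∞ := by
  rw [minSmoothness_of_isRCLikeNormedField]
  exact ENat.LEInfty.out

/-- In coordinates this is naturality of `extDeriv`, applied to `f` read in the charts at `x` and `f
x`. -/
theorem extD_pullback {f : M → N} {x : M} (hf : ContMDiffAt 𝓘(ℝ, E) 𝓘(ℝ, E') ∞ f x)
    {θ : Form E' N p V} (hθ : SmoothFormAt θ (f x)) :
    extD (pullback (E := E) f θ) x = pullback f (extD θ) x := by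
  have hc := contDiffAt_inCharts hf
  have hθ' : DifferentiableAt ℝ (chartRep (f x) θ)
      (inCharts f x (extChartAt 𝓘(ℝ, E) x x)) := by
    rw [inCharts_self]
    exact ContDiffAt.differentiableAt hθ (by simp)
  rw [extD_eq, (chartRep_pullback hf θ).extDeriv_eq, extDeriv_pullback hθ' hc two_le_smooth]
  simp only [pullback, extD_eq, inCharts_self,
    tmap_eq_fderiv_inCharts (hf.mdifferentiableAt (by simp))]

/-- `extD` uses a different chart at each point, so its smoothness is not immediate. Naturality
along the inverse of one fixed chart shows that, near `x`, it is represented there by the `extDeriv`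
of the representative of `θ`. -/
theorem SmoothFormAt.extD {θ : Form E M p V} {x : M} (hθ : ∀ᶠ y in 𝓝 x, SmoothFormAt θ y) :
    SmoothFormAt (CovLie.extD θ) x := by
  have h : chartRep x (CovLie.extD θ) =ᶠ[𝓝 (extChartAt 𝓘(ℝ, E) x x)] extDeriv (chartRep x θ) := by
    filter_upwards [(tendsto_extChartAt_symm (E := E) x).eventually hθ,
      eventually_mem_target (E := E) x] with y hy hyt
    rw [← extD_model]
    exact (extD_pullback (contMDiffAt_extChartAt_symm hyt) hy).symm
  refine ContDiffAt.congr_of_eventuallyEq ?_ h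
  exact (ContinuousAlternatingMap.alternatizeUncurryFinCLM ℝ E V).contDiff.contDiffAt.comp _
    (ContDiffAt.fderiv_right (n := ∞) (m := ∞) hθ.self_of_nhds (by simp))

end FormCalculus

/-! ### Contraction, wedge products and Cartan's formula -/

section FormAlgebra
variable {E : Type*} [NormedAddCommGroup E] [NormedSpace ℝ E]
  {M : Type*} [TopologicalSpace M] [ChartedSpace E M]
  {E' : Type*} [NormedAddCommGroup E'] [NormedSpace ℝ E']
  {N : Type*} [TopologicalSpace N] [ChartedSpace E' N]
  {V : Type*} [NormedAddCommGroup V] [NormedSpace ℝ V]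
  {W : Type*} [NormedAddCommGroup W] [NormedSpace ℝ W]
  {p : ℕ}

theorem removeNth_succ_cons {α : Type*} {n : ℕ} (i : Fin (n + 1)) (a : α) (v : Fin (n + 1) → α) :
    i.succ.removeNth (Fin.cons a v : Fin (n + 2) → α) =
      (Fin.cons a (i.removeNth v) : Fin (n + 1) → α) := by
  funext j
  refine Fin.cases ?_ (fun j => ?_) j <;> simp [Fin.removeNth]

omit [TopologicalSpace M] [ChartedSpace E M] in
theorem iprod_apply (Z : M → E) (θ : Form E M (p + 1) V) (x : M) (v : Fin p → E) :
    iprod Z θ x v = θ x (Fin.cons (Z x) v) := rfl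

omit [TopologicalSpace M] [ChartedSpace E M] in
theorem wedgeZero_apply (a : W →L[ℝ] V →L[ℝ] V) (l : Form E M 0 W) (θ : Form E M p V) (x : M)
    (v : Fin p → E) : wedgeZero a l θ x v = a (l x ![]) (θ x v) := rfl

theorem pullback_iprod {f : M → N} {x : M} {Z : M → E} {Z' : N → E'}
    (h : tmap f x (Z x) = Z' (f x)) (θ : Form E' N (p + 1) V) :
    pullback f (iprod Z' θ) x = iprod Z (pullback f θ) x := by
  ext v
  simp only [pullback_apply, iprod_apply, ← h]
  congr 1
  funext i
  refine Fin.cases ?_ (fun j => ?_) i <;> simp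

theorem pullback_wedge (f : M → N) (a : W →L[ℝ] V →L[ℝ] V) (α : Form E' N 1 W)
    (θ : Form E' N p V) :
    pullback (E := E) f (wedge a α θ) = wedge a (pullback f α) (pullback f θ) := by
  ext x v
  simp only [pullback_apply, wedge_apply]
  refine Finset.sum_congr rfl fun i _ => ?_
  congr 3
  congr 1
  funext j
  simp

theorem pullback_wedgeZero (f : M → N) (a : W →L[ℝ] V →L[ℝ] V) (l : Form E' N 0 W)
    (θ : Form E' N p V) :
    pullback (E := E) f (wedgeZero a l θ) = wedgeZero a (pullback f l) (pullback f θ) := by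
  ext x v
  simp only [pullback_apply, wedgeZero_apply]
  congr 3
  exact Subsingleton.elim _ _

theorem iprod_wedge_zero (Z : M → E) (a : W →L[ℝ] V →L[ℝ] V) (α : Form E M 1 W)
    (θ : Form E M 0 V) : iprod Z (wedge a α θ) = wedgeZero a (iprod Z α) θ := by
  ext x v
  simp only [iprod_apply, wedgeZero_apply, wedge_apply]
  rw [Fin.sum_univ_succ]
  simp

/-- The term in which `α` receives `Z` gives the first summand; in all others `Z` remains the first
argument of `θ`, and shifting the index by one produces the minus sign. -/
theorem iprod_wedge_succ (Z : M → E) (a : W →L[ℝ] V →L[ℝ] V) (α : Form E M 1 W)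
    (θ : Form E M (p + 1) V) :
    iprod Z (wedge a α θ) = wedgeZero a (iprod Z α) θ - wedge a α (iprod Z θ) := by
  ext x v
  change _ = wedgeZero a (iprod Z α) θ x v - wedge a α (iprod Z θ) x v
  simp only [iprod_apply, wedgeZero_apply, wedge_apply]
  rw [Fin.sum_univ_succ, sub_eq_add_neg, ← Finset.sum_neg_distrib]
  congr 1
  · simp
  · refine Finset.sum_congr rfl fun i _ => ?_
    rw [Fin.val_succ, pow_succ, mul_neg_one, neg_smul, Fin.cons_succ]
    congr 4
    exact removeNth_succ_cons i (Z x) v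

/-- The two terms `α ∧ ι_Z θ` cancel. The identity needs no smoothness and no relation between `α`
and `Z`; it is used with `A^#`, with the lift of `ξ`, and with `ξ` itself. -/
theorem lieD_eq_covD (Z : M → E) (a : W →L[ℝ] V →L[ℝ] V) (α : Form E M 1 W) (θ : Form E M p V) :
    lieD Z θ = iprod Z (covD a α θ) + covDInterior a α Z θ - wedgeZero a (iprod Z α) θ := by
  have hadd : ∀ {q : ℕ} (η η' : Form E M (q + 1) V), iprod Z (η + η') = iprod Z η + iprod Z η' :=
    fun η η' => rfl
  cases p with
  | zero =>
    simp only [lieD, covD, covDInterior, hadd, iprod_wedge_zero]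
    abel
  | succ p =>
    simp only [lieD, covD, covDInterior, hadd, iprod_wedge_succ]
    abel

theorem wedgeZero_eq_neg_wedge {a : V →L[ℝ] V →L[ℝ] V} (ha : ∀ A B, a A B = -a B A)
    (l : Form E M 0 V) (α : Form E M 1 V) : wedgeZero a l α = -wedge a α l := by
  ext x v
  change wedgeZero a l α x v = -(wedge a α l x v)
  rw [wedgeZero_apply, wedge_apply, ha]
  simp only [Fin.sum_univ_succ, Finset.univ_eq_empty, Finset.sum_empty, Fin.val_zero, pow_zero,
    one_smul, add_zero]
  congr 3
  · congr 1
    funext i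
    simp [Subsingleton.elim i 0]
  · exact Subsingleton.elim _ _

/-- Skewness gives `ι_Z (½ α ∧ α) = -α ∧ ι_Z α`, which cancels the algebraic part of `d^α (ι_Z α)`.
The Jacobi identity plays no role. -/
theorem lieD_one_form (Z : M → E) {a : V →L[ℝ] V →L[ℝ] V} (ha : ∀ A B, a A B = -a B A)
    (α : Form E M 1 V) :
    lieD Z α = iprod Z (extD α + (1 / 2 : ℝ) • wedge a α α) + covD a α (iprod Z α) := by
  have h : iprod Z (extD α + (1 / 2 : ℝ) • wedge a α α) =
      iprod Z (extD α) + (1 / 2 : ℝ) • iprod Z (wedge a α α) := rfl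
  rw [h, iprod_wedge_succ, wedgeZero_eq_neg_wedge ha, lieD, covD]
  module

theorem wedgeZero_sub (a : W →L[ℝ] V →L[ℝ] V) (l l' : Form E M 0 W) (θ : Form E M p V) :
    wedgeZero a (l - l') θ = wedgeZero a l θ - wedgeZero a l' θ := by
  ext x v
  change a (l x ![] - l' x ![]) (θ x v) = a (l x ![]) (θ x v) - a (l' x ![]) (θ x v)
  rw [map_sub]
  rfl

theorem wedge_sub (a : W →L[ℝ] V →L[ℝ] V) (α : Form E M 1 W) (θ θ' : Form E M p V) :
    wedge a α (θ - θ') = wedge a α θ - wedge a α θ' := by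
  ext x v
  change wedge a α (θ - θ') x v = wedge a α θ x v - wedge a α θ' x v
  simp only [wedge_apply, ← Finset.sum_sub_distrib, ← smul_sub, ← map_sub]
  rfl

end FormAlgebra

/-! ### Smoothness and equivariance of Lie derivatives -/

section Smoothness
variable {E : Type*} [NormedAddCommGroup E] [NormedSpace ℝ E]
  {M : Type*} [TopologicalSpace M] [ChartedSpace E M] [IsManifold 𝓘(ℝ, E) ∞ M]
  {E' : Type*} [NormedAddCommGroup E'] [NormedSpace ℝ E']
  {N : Type*} [TopologicalSpace N] [ChartedSpace E' N] [IsManifold 𝓘(ℝ, E') ∞ N]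
  {V : Type*} [NormedAddCommGroup V] [NormedSpace ℝ V]
  {W : Type*} [NormedAddCommGroup W] [NormedSpace ℝ W]
  {p : ℕ}

theorem SmoothFormAt.add {θ θ' : Form E M p V} {x : M} (h : SmoothFormAt θ x)
    (h' : SmoothFormAt θ' x) : SmoothFormAt (θ + θ') x :=
  ContDiffAt.add h h'

theorem extD_sub {θ θ' : Form E M p V} {x : M} (h : SmoothFormAt θ x) (h' : SmoothFormAt θ' x) :
    extD (θ - θ') x = extD θ x - extD θ' x := by
  have e : chartRep x (θ - θ') = chartRep x θ - chartRep x θ' := rfl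
  rw [extD_eq, extD_eq, extD_eq, extDeriv, e,
    fderiv_sub (ContDiffAt.differentiableAt h (by simp)) (ContDiffAt.differentiableAt h' (by simp))]
  exact map_sub (ContinuousAlternatingMap.alternatizeUncurryFinCLM ℝ E V) _ _

theorem covD_sub (a : W →L[ℝ] V →L[ℝ] V) (α : Form E M 1 W) {θ θ' : Form E M p V} {x : M}
    (h : SmoothFormAt θ x) (h' : SmoothFormAt θ' x) :
    covD a α (θ - θ') x = covD a α θ x - covD a α θ' x := by
  simp only [covD, wedge_sub, Pi.add_apply, Pi.sub_apply, extD_sub h h']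
  abel

theorem extD_zero (x : M) : extD (0 : Form E M p V) x = 0 := by
  have h : SmoothFormAt (0 : Form E M p V) x := by
    have e : chartRep x (0 : Form E M p V) = fun _ => 0 := rfl
    rw [SmoothFormAt, e]
    exact contDiffAt_const
  simpa using extD_sub h h

theorem extD_const (c : E [⋀^Fin 0]→L[ℝ] V) (x : M) :
    extD (fun _ => c : Form E M 0 V) x = 0 := by
  have e : chartRep x (fun _ => c : Form E M 0 V) = fun _ => c := by
    funext y
    ext v
    simp only [chartRep, pullback_apply]
    congr 1
    exact Subsingleton.elim _ _
  rw [extD_eq, extDeriv, e, fderiv_const_apply]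
  exact map_zero (ContinuousAlternatingMap.alternatizeUncurryFinCLM ℝ E V)

theorem extD_compContinuousAlternatingMap (A : V →L[ℝ] W) {θ : Form E M p V} {x : M}
    (h : SmoothFormAt θ x) :
    extD (fun y => A.compContinuousAlternatingMap (θ y)) x =
      A.compContinuousAlternatingMap (extD θ x) := by
  have hd : DifferentiableAt ℝ (chartRep x θ) (extChartAt 𝓘(ℝ, E) x x) :=
    ContDiffAt.differentiableAt h (by simp)
  have e : chartRep x (fun y => A.compContinuousAlternatingMap (θ y)) =
    fun y => A.compContinuousAlternatingMap (chartRep x θ y) := rfl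
  have hd' : DifferentiableAt ℝ (fun y => A.compContinuousAlternatingMap (chartRep x θ y))
      (extChartAt 𝓘(ℝ, E) x x) :=
    (ContDiffAt.compContinuousAlternatingMap (n := 1) contDiffAt_const
      (ContDiffAt.of_le h (by simp))).differentiableAt one_ne_zero
  ext v
  rw [extD_eq, extD_eq, e, extDeriv_apply hd']
  simp only [ContinuousLinearMap.compContinuousAlternatingMap_coe, Function.comp_apply]
  rw [extDeriv_apply hd, map_sum]
  refine Finset.sum_congr rfl fun i _ => ?_
  have hh : DifferentiableAt ℝ (fun y => chartRep x θ y (i.removeNth v))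
      (extChartAt 𝓘(ℝ, E) x x) := by
    exact hd.continuousAlternatingMap_apply_const _
  have h3 := A.hasFDerivAt.comp _ hh.hasFDerivAt
  rw [map_zsmul]
  congr 1
  exact congrArg (fun B => B (v i)) h3.fderiv

/-- Smoothness of a vector field at a point. -/
def SmoothVecAt (Z : M → E) (x : M) : Prop :=
  ContMDiffAt 𝓘(ℝ, E) 𝓘(ℝ, E).tangent ∞
    (fun y => (⟨y, Z y⟩ : TangentBundle 𝓘(ℝ, E) M)) x

theorem VecField.smoothVecAt (Z : VecField E M) (x : M) : SmoothVecAt Z.val x :=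
  Z.contMDiff x

theorem tmap_extChartAt_symm_comp {x : M} {y : E} (hy : y ∈ (extChartAt 𝓘(ℝ, E) x).target) (v : E) :
    tmap (E := E) (E' := E) (extChartAt 𝓘(ℝ, E) x).symm y
      (tmap (E := E) (E' := E) (extChartAt 𝓘(ℝ, E) x) ((extChartAt 𝓘(ℝ, E) x).symm y) v) = v := by
  have h := mfderivWithin_extChartAt_symm_comp_mfderiv_extChartAt (I := 𝓘(ℝ, E)) hy
  rw [ModelWithCorners.range_eq_univ, mfderivWithin_univ] at h
  exact congrArg (fun B : E →L[ℝ] E => B v) h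

/-- On the source of the chart at `x`, the tangent bundle trivialization is the tangent map of that
chart, so smoothness as a section means smoothness of this coordinate expression. -/
theorem SmoothVecAt.contMDiffAt_tmap {Z : M → E} {x : M} (h : SmoothVecAt Z x) :
    ContMDiffAt 𝓘(ℝ, E) 𝓘(ℝ, E) ∞
      (fun y => tmap (E := E) (E' := E) (extChartAt 𝓘(ℝ, E) x) y (Z y)) x := by
  refine ((Bundle.contMDiffAt_section x).1 h).congr_of_eventuallyEq ?_
  filter_upwards [(chartAt E x).open_source.mem_nhds (mem_chart_source E x)] with y hy
  rw [tmap, ← TangentBundle.continuousLinearMapAt_trivializationAt hy]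
  exact Bundle.Trivialization.continuousLinearMapAt_apply_of_mem _ _ hy _

theorem contDiff_curryLeft {n : WithTop ℕ∞} :
    ContDiff ℝ n (ContinuousAlternatingMap.curryLeft (𝕜 := ℝ) (E := E) (F := V) (n := p)) :=
  (IsLinearMap.with_bound ⟨fun _ _ => rfl, fun _ _ => rfl⟩ 1 fun f => by
    rw [ContinuousAlternatingMap.norm_curryLeft, one_mul]).contDiff

theorem SmoothFormAt.iprod {Z : M → E} {θ : Form E M (p + 1) V} {x : M} (hZ : SmoothVecAt Z x)
    (h : SmoothFormAt θ x) : SmoothFormAt (CovLie.iprod Z θ) x := by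
  -- `Z₁` is `Z` in the coordinates at `x`; contraction is natural for the inverse chart, which
  -- carries `Z₁` to `Z`.
  set Z₁ : E → E := fun y => tmap (E := E) (E' := E) (extChartAt 𝓘(ℝ, E) x)
    ((extChartAt 𝓘(ℝ, E) x).symm y) (Z ((extChartAt 𝓘(ℝ, E) x).symm y))
  have he : chartRep x (CovLie.iprod Z θ) =ᶠ[𝓝 (extChartAt 𝓘(ℝ, E) x x)]
      fun y => (chartRep x θ y).curryLeft (Z₁ y) := by
    filter_upwards [eventually_mem_target (E := E) x] with y hy
    exact pullback_iprod (tmap_extChartAt_symm_comp hy _) θ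
  refine ContDiffAt.congr_of_eventuallyEq ?_ he
  have hZ₁ : ContDiffAt ℝ ∞ Z₁ (extChartAt 𝓘(ℝ, E) x x) := by
    refine ContMDiffAt.contDiffAt ?_
    refine ContMDiffAt.comp_of_eq hZ.contMDiffAt_tmap
      (contMDiffAt_extChartAt_symm (mem_extChartAt_target x)) (extChartAt_to_inv x)
  refine ContDiffAt.clm_apply ?_ hZ₁
  exact contDiff_curryLeft.contDiffAt.comp _ h

theorem SmoothFormAt.lieD {Z : M → E} {θ : Form E M p V} {x : M} (hZ : ∀ᶠ y in 𝓝 x, SmoothVecAt Z y)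
    (h : ∀ᶠ y in 𝓝 x, SmoothFormAt θ y) : SmoothFormAt (CovLie.lieD Z θ) x := by
  cases p with
  | zero => exact (SmoothFormAt.extD h).iprod hZ.self_of_nhds
  | succ p =>
    exact (SmoothFormAt.extD ((hZ.and h).mono fun y hy => hy.2.iprod hy.1)).add
      ((SmoothFormAt.extD h).iprod hZ.self_of_nhds)

/-- The Lie derivative commutes with pullback and with linear maps of the coefficients. -/
theorem lieD_equivariant {f : M → M} (hf : ContMDiff 𝓘(ℝ, E) 𝓘(ℝ, E) ∞ f) {Z : M → E}
    (hZ : ∀ x, SmoothVecAt Z x) (hfZ : ∀ x, tmap f x (Z x) = Z (f x)) {θ : Form E M p V}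
    (hθ : ∀ x, SmoothFormAt θ x) (A : V →L[ℝ] V)
    (hA : ∀ x, pullback f θ x = A.compContinuousAlternatingMap (θ x)) (x : M) :
    pullback f (lieD Z θ) x = A.compContinuousAlternatingMap (lieD Z θ x) := by
  have hA' := funext hA
  have hd : ∀ {q : ℕ} (η : Form E M q V), (∀ x, SmoothFormAt η x) →
      pullback f η = (fun x => A.compContinuousAlternatingMap (η x)) →
      pullback f (extD η) = fun x => A.compContinuousAlternatingMap (extD η x) := by
    intro q η hη h
    funext x
    rw [← extD_pullback (hf x) (hη _), h, extD_compContinuousAlternatingMap A (hη x)]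
  have hi : ∀ {q : ℕ} (η : Form E M (q + 1) V),
      pullback f η = (fun x => A.compContinuousAlternatingMap (η x)) →
      pullback f (iprod Z η) = fun x => A.compContinuousAlternatingMap (iprod Z η x) := by
    intro q η h
    funext x
    rw [pullback_iprod (hfZ x), h]
    rfl
  suffices h : pullback (E := E) f (lieD Z θ) = fun x => A.compContinuousAlternatingMap (lieD Z θ x) from
    congrFun h x
  cases p with
  | zero => exact hi _ (hd _ hθ hA')
  | succ p =>
    have h1 := hi _ (hd _ hθ hA')
    have h2 := hd _ (fun x => (hθ x).iprod (hZ x)) (hi _ hA')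
    have e : pullback (E := E) f (lieD Z θ) =
      pullback f (extD (iprod Z θ)) + pullback f (iprod Z (extD θ)) := rfl
    rw [e, h1, h2]
    funext x
    ext v
    exact (map_add A _ _).symm

end Smoothness

/-! ### First-order calculus on a Lie group -/

section LieGroupCalculus
variable {EG : Type*} [NormedAddCommGroup EG] [NormedSpace ℝ EG]
  {G : Type*} [TopologicalSpace G] [ChartedSpace EG G] [Group G] [LieGroup 𝓘(ℝ, EG) ∞ G]
  {EP : Type*} [NormedAddCommGroup EP] [NormedSpace ℝ EP]
  {P : Type*} [TopologicalSpace P] [ChartedSpace EP P]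
  {EX : Type*} [NormedAddCommGroup EX] [NormedSpace ℝ EX]
  {X : Type*} [TopologicalSpace X] [ChartedSpace EX X]

/-- The tangent map of a map of two variables along a pair of curves. -/
theorem tmap_two_variables {f : X → G → P} {E : Type*} [NormedAddCommGroup E] [NormedSpace ℝ E]
    {M : Type*} [TopologicalSpace M] [ChartedSpace E M] {b : M → X} {c : M → G} {m : M}
    (hf : MDifferentiableAt (𝓘(ℝ, EX).prod 𝓘(ℝ, EG)) 𝓘(ℝ, EP) (fun q : X × G => f q.1 q.2)
      (b m, c m))
    (hb : MDifferentiableAt 𝓘(ℝ, E) 𝓘(ℝ, EX) b m) (hc : MDifferentiableAt 𝓘(ℝ, E) 𝓘(ℝ, EG) c m)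
    (v : E) :
    tmap (E' := EP) (fun z => f (b z) (c z)) m v =
      tmap (E' := EP) (fun x => f x (c m)) (b m) (tmap (E' := EX) b m v) +
      tmap (E' := EP) (fun g => f (b m) g) (c m) (tmap (E' := EG) c m v) := by
  have h1 := mfderiv_comp m hf (hb.prodMk hc)
  rw [mfderiv_prodMk hb hc] at h1
  have h2 := congrArg (fun B : E →L[ℝ] EP => B v) h1
  refine h2.trans ?_
  exact mfderiv_prod_eq_add_apply hf

/-- Differentiate `g * g⁻¹ = 1` with the two-variable rule. -/
theorem tmap_inv_one (A : EG) : tmap (E := EG) (E' := EG) (fun g : G => g⁻¹) 1 A = -A := by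
  have hm : ContMDiff (𝓘(ℝ, EG).prod 𝓘(ℝ, EG)) 𝓘(ℝ, EG) ∞ (fun q : G × G => q.1 * q.2) :=
    contMDiff_mul 𝓘(ℝ, EG) ∞
  have hi : ContMDiff 𝓘(ℝ, EG) 𝓘(ℝ, EG) ∞ (fun g : G => g⁻¹) := contMDiff_inv 𝓘(ℝ, EG) ∞
  have h := tmap_two_variables (E := EG) (f := fun g h : G => g * h) (b := fun g : G => g)
    (c := fun g : G => g⁻¹) (m := 1) (hm.mdifferentiableAt (by simp)) mdifferentiableAt_id
    (hi.mdifferentiableAt (by simp)) A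
  simp only [mul_inv_cancel, inv_one, mul_one, one_mul, tmap_id, tmap_const] at h
  exact (neg_eq_of_add_eq_zero_right (by simpa using h.symm)).symm

/-- A curve in `G` through `1` with velocity `A`. -/
def curveAt (G : Type*) [TopologicalSpace G] [ChartedSpace EG G] [Group G] (A : EG) (t : ℝ) : G :=
  (extChartAt 𝓘(ℝ, EG) (1 : G)).symm (extChartAt 𝓘(ℝ, EG) (1 : G) 1 + t • A)

theorem curveAt_zero (A : EG) : curveAt G A 0 = 1 := by
  simp [curveAt]

theorem contMDiffAt_curveAt (A : EG) : ContMDiffAt 𝓘(ℝ, ℝ) 𝓘(ℝ, EG) ∞ (curveAt G A) 0 := by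
  refine ContMDiffAt.comp_of_eq (I' := 𝓘(ℝ, EG))
    (contMDiffAt_extChartAt_symm (mem_extChartAt_target (1 : G))) ?_ (by simp)
  exact ContDiffAt.contMDiffAt (by fun_prop)

theorem tmap_extChartAt_symm_self {M : Type*} [TopologicalSpace M] [ChartedSpace EX M]
    [IsManifold 𝓘(ℝ, EX) ∞ M] (x : M) (v : EX) :
    tmap (E' := EX) (extChartAt 𝓘(ℝ, EX) x).symm (extChartAt 𝓘(ℝ, EX) x x) v = v := by
  have h := tmap_extChartAt_symm_comp (mem_extChartAt_target (I := 𝓘(ℝ, EX)) x) v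
  rw [extChartAt_to_inv, tmap_extChartAt_self] at h
  exact h

theorem tmap_curveAt (A : EG) (s : ℝ) :
    tmap (E := ℝ) (E' := EG) (curveAt G A) 0 s = s • A := by
  have hl : HasFDerivAt (fun t : ℝ => extChartAt 𝓘(ℝ, EG) (1 : G) 1 + t • A)
      ((ContinuousLinearMap.id ℝ ℝ).smulRight A) 0 :=
    ((ContinuousLinearMap.id ℝ ℝ).smulRight A).hasFDerivAt.const_add _
  have h0 : extChartAt 𝓘(ℝ, EG) (1 : G) 1 + (0 : ℝ) • A = extChartAt 𝓘(ℝ, EG) (1 : G) 1 := by simp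
  have hs := (contMDiffAt_extChartAt_symm (n := ∞) (mem_extChartAt_target (I := 𝓘(ℝ, EG))
    (1 : G))).mdifferentiableAt (by simp)
  rw [← h0] at hs
  have h := tmap_comp (E'' := EG)
    (f := fun t : ℝ => extChartAt 𝓘(ℝ, EG) (1 : G) 1 + t • A) (x := 0) hs hl.differentiableAt.mdifferentiableAt
  rw [tmap_eq_fderiv, hl.fderiv, h0] at h
  refine (congrArg (fun B : ℝ →L[ℝ] EG => B s) h).trans ?_
  exact tmap_extChartAt_symm_self (1 : G) (s • A)

end LieGroupCalculus

/-! ### The Lie derivative along fundamental vector fields -/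

section LieDerivativeAlongAction
variable {EX : Type*} [NormedAddCommGroup EX] [NormedSpace ℝ EX]
  {X : Type*} [TopologicalSpace X] [ChartedSpace EX X]
  {EG : Type*} [NormedAddCommGroup EG] [NormedSpace ℝ EG]
  {G : Type*} [TopologicalSpace G] [ChartedSpace EG G] [Group G] [LieGroup 𝓘(ℝ, EG) ∞ G]
  {EP : Type*} [NormedAddCommGroup EP] [NormedSpace ℝ EP]
  {P : Type*} [TopologicalSpace P] [ChartedSpace EP P] [IsManifold 𝓘(ℝ, EP) ∞ P]
  {V : Type*} [NormedAddCommGroup V] [NormedSpace ℝ V] {p : ℕ}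
  (B : PrincipalBundle EX X EG G EP P)

/-- The action along a curve in `G`, in a chart of `P`. -/
def actionFlow (A : EG) (u : P) (q : ℝ × EP) : P :=
  B.act ((extChartAt 𝓘(ℝ, EP) u).symm q.2) (curveAt G A q.1)

theorem actionFlow_zero (A : EG) (u : P) (y : EP) :
    actionFlow B A u (0, y) = (extChartAt 𝓘(ℝ, EP) u).symm y := by
  simp [actionFlow, curveAt_zero, B.act_one]

theorem contMDiffAt_actionFlow (A : EG) {u : P} {y : EP}
    (hy : y ∈ (extChartAt 𝓘(ℝ, EP) u).target) :
    ContMDiffAt 𝓘(ℝ, ℝ × EP) 𝓘(ℝ, EP) ∞ (actionFlow B A u) (0, y) := by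
  have h1 : ContMDiffAt 𝓘(ℝ, ℝ × EP) 𝓘(ℝ, EP) ∞
      (fun q : ℝ × EP => (extChartAt 𝓘(ℝ, EP) u).symm q.2) (0, y) :=
    ContMDiffAt.comp (I' := 𝓘(ℝ, EP)) (0, y) (contMDiffAt_extChartAt_symm hy)
      contDiffAt_snd.contMDiffAt
  have h2 : ContMDiffAt 𝓘(ℝ, ℝ × EP) 𝓘(ℝ, EG) ∞ (fun q : ℝ × EP => curveAt G A q.1) (0, y) :=
    ContMDiffAt.comp (I' := 𝓘(ℝ, ℝ)) (g := curveAt G A) (0, y) (contMDiffAt_curveAt A) contDiffAt_fst.contMDiffAt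
  exact (B.act_smooth.contMDiffAt).comp (0, y) (h1.prodMk h2)

theorem tmap_actionFlow (A : EG) {u : P} {y : EP} {t : ℝ}
    (hy : y ∈ (extChartAt 𝓘(ℝ, EP) u).target)
    (ht : MDifferentiableAt 𝓘(ℝ, ℝ) 𝓘(ℝ, EG) (curveAt G A) t) (s : ℝ) (v : EP) :
    tmap (E := ℝ × EP) (E' := EP) (actionFlow B A u) (t, y) (s, v) =
      tmap (fun w => B.act w (curveAt G A t)) ((extChartAt 𝓘(ℝ, EP) u).symm y)
        (tmap (E' := EP) (extChartAt 𝓘(ℝ, EP) u).symm y v) +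
      tmap (B.act ((extChartAt 𝓘(ℝ, EP) u).symm y)) (curveAt G A t)
        (tmap (E' := EG) (curveAt G A) t s) := by
  have hsym := (contMDiffAt_extChartAt_symm (n := ∞) hy).mdifferentiableAt (by simp)
  have e1 := tmap_comp (E := ℝ × EP) (E'' := EP) (f := Prod.snd) (x := (t, y)) hsym
    differentiableAt_snd.mdifferentiableAt
  have e2 := tmap_comp (E := ℝ × EP) (E'' := EG) (f := Prod.fst) (x := (t, y)) ht
    differentiableAt_fst.mdifferentiableAt
  have h := tmap_two_variables (f := B.act) (E := ℝ × EP) (m := (t, y))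
    (b := (extChartAt 𝓘(ℝ, EP) u).symm ∘ Prod.snd) (c := curveAt G A ∘ Prod.fst)
    (B.act_smooth.mdifferentiableAt (by simp))
    (hsym.comp (t, y) differentiableAt_snd.mdifferentiableAt)
    (ht.comp (t, y) differentiableAt_fst.mdifferentiableAt) (s, v)
  rw [e1, e2, tmap_eq_fderiv, tmap_eq_fderiv, fderiv_snd, fderiv_fst] at h
  exact h

end LieDerivativeAlongAction

section LieDerivativeAlongAction
variable {EX : Type*} [NormedAddCommGroup EX] [NormedSpace ℝ EX]
  {X : Type*} [TopologicalSpace X] [ChartedSpace EX X]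
  {EG : Type*} [NormedAddCommGroup EG] [NormedSpace ℝ EG]
  {G : Type*} [TopologicalSpace G] [ChartedSpace EG G] [Group G] [LieGroup 𝓘(ℝ, EG) ∞ G]
  {EP : Type*} [NormedAddCommGroup EP] [NormedSpace ℝ EP]
  {P : Type*} [TopologicalSpace P] [ChartedSpace EP P] [IsManifold 𝓘(ℝ, EP) ∞ P]
  {V : Type*} [NormedAddCommGroup V] [NormedSpace ℝ V] {p : ℕ}
  (B : PrincipalBundle EX X EG G EP P)

/-- With `t` frozen, the map is the inverse chart followed by the action of one group element, so
equivariance evaluates the pullback on spatial vectors. It is needed for all `t` near `0`, to be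
differentiated in `t`. -/
theorem pullback_actionFlow_inr (A : EG) {u : P} {y : EP} {t : ℝ}
    (hy : y ∈ (extChartAt 𝓘(ℝ, EP) u).target)
    (ht : MDifferentiableAt 𝓘(ℝ, ℝ) 𝓘(ℝ, EG) (curveAt G A) t) {Θ : Form EP P p V}
    {a : G → V →L[ℝ] V}
    (heq : ∀ g u, pullback (fun w => B.act w g) Θ u = (a g⁻¹).compContinuousAlternatingMap (Θ u))
    (v : Fin p → EP) :
    pullback (E := ℝ × EP) (actionFlow B A u) Θ (t, y) (fun i => (0, v i)) =
      a (curveAt G A t)⁻¹ (chartRep u Θ y v) := by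
  have h := congrArg (fun θ => θ fun i => tmap (E' := EP) (extChartAt 𝓘(ℝ, EP) u).symm y (v i))
    (heq (curveAt G A t) ((extChartAt 𝓘(ℝ, EP) u).symm y))
  refine Eq.trans ?_ h
  simp only [pullback_apply, tmap_actionFlow B A hy ht, map_zero, add_zero]
  rfl

/-- At `t = 0` the time direction maps to `A^#`, and the spatial part is the inverse chart because
`curveAt` starts at `1`. -/
theorem pullback_actionFlow_cons (A : EG) {u : P} {y : EP}
    (hy : y ∈ (extChartAt 𝓘(ℝ, EP) u).target) (Θ : Form EP P (p + 1) V) (v : Fin p → EP) :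
    pullback (E := ℝ × EP) (actionFlow B A u) Θ (0, y)
        (Fin.cons ((1, 0) : ℝ × EP) fun i => (0, v i)) =
      chartRep u (iprod (B.fundamental A) Θ) y v := by
  have hc := (contMDiffAt_curveAt (G := G) A).mdifferentiableAt (by simp)
  have hid : (fun w => B.act w (curveAt G A 0)) = fun w => w := by
    funext w; rw [curveAt_zero, B.act_one]
  simp only [pullback_apply, chartRep, iprod_apply, actionFlow_zero]
  congr 1
  funext i
  refine Fin.cases ?_ (fun j => ?_) i
  · simp only [Fin.cons_zero, tmap_actionFlow B A hy hc, tmap_curveAt, map_zero, zero_add, one_smul,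
      curveAt_zero]
    rfl
  · simp only [Fin.cons_succ, tmap_actionFlow B A hy hc, map_zero, add_zero, hid, tmap_id]
    rfl

/-- The minus sign is the derivative of inversion at `1`. Only differentiability of `a` at `1`
enters, not multiplicativity. -/
theorem hasDerivAt_comp_curveAt_inv {a : G → V →L[ℝ] V}
    (ha : MDifferentiableAt 𝓘(ℝ, EG) 𝓘(ℝ, V →L[ℝ] V) a 1) {D : EG →L[ℝ] V →L[ℝ] V}
    (hD : tmap a 1 = D) (A : EG) :
    HasDerivAt (fun t : ℝ => a (curveAt G A t)⁻¹) (-D A) 0 := by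
  have hi : MDifferentiableAt 𝓘(ℝ, EG) 𝓘(ℝ, EG) (fun g : G => g⁻¹) 1 :=
    (contMDiff_inv 𝓘(ℝ, EG) ∞).mdifferentiableAt (by simp)
  have hc := (contMDiffAt_curveAt (G := G) A).mdifferentiableAt (by simp)
  rw [← curveAt_zero (G := G) A] at hi
  have hic : MDifferentiableAt 𝓘(ℝ, ℝ) 𝓘(ℝ, EG) ((fun g : G => g⁻¹) ∘ curveAt G A) 0 :=
    hi.comp 0 hc
  have h1 := tmap_comp (E := ℝ) hi hc
  have ha' : MDifferentiableAt 𝓘(ℝ, EG) 𝓘(ℝ, V →L[ℝ] V) a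
      (((fun g : G => g⁻¹) ∘ curveAt G A) 0) := by
    simpa [curveAt_zero] using ha
  have h2 := tmap_comp (E := ℝ) ha' hic
  have hd : DifferentiableAt ℝ (fun t : ℝ => a (curveAt G A t)⁻¹) 0 :=
    (ha'.comp 0 hic).differentiableAt
  rw [h1, tmap_eq_fderiv] at h2
  have h3 : fderiv ℝ (fun t : ℝ => a (curveAt G A t)⁻¹) 0 1 = -D A := by
    refine (congrArg (fun B : ℝ →L[ℝ] V →L[ℝ] V => B 1) h2).trans ?_
    simp [curveAt_zero, tmap_curveAt, tmap_inv_one, hD]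
  rw [← h3]
  exact hd.hasFDerivAt.hasDerivAt

theorem chartRep_self (Θ : Form EP P p V) (u : P) (v : Fin p → EP) :
    chartRep u Θ (extChartAt 𝓘(ℝ, EP) u u) v = Θ u v := by
  simp only [chartRep, pullback_apply, tmap_extChartAt_symm_self, extChartAt_to_inv]

/-- The Lie derivative of an equivariant form along a fundamental vector field. -/
theorem lieD_fundamental (A : EG) {Θ : Form EP P p V}
    (hΘ : ∀ u, SmoothFormAt Θ u) {a : G → V →L[ℝ] V}
    (ha : MDifferentiableAt 𝓘(ℝ, EG) 𝓘(ℝ, V →L[ℝ] V) a 1) {D : EG →L[ℝ] V →L[ℝ] V}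
    (hD : tmap a 1 = D)
    (heq : ∀ g u, pullback (fun w => B.act w g) Θ u = (a g⁻¹).compContinuousAlternatingMap (Θ u))
    (u : P) : lieD (B.fundamental A) Θ u = -(D A).compContinuousAlternatingMap (Θ u) := by
  set y₀ := extChartAt 𝓘(ℝ, EP) u u with hy₀
  have hy : y₀ ∈ (extChartAt 𝓘(ℝ, EP) u).target := mem_extChartAt_target u
  -- The computation moves to `ℝ × EP`, where `A^#` becomes the constant field `(1, 0)` at time `0`
  -- and `dη` is the pullback of `dΘ`.
  set η := pullback (E := ℝ × EP) (actionFlow B A u) Θ with hη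
  have hsm : SmoothFormAt η (0, y₀) := (hΘ _).pullback (contMDiffAt_actionFlow B A hy)
  have hdiff : DifferentiableAt ℝ η (0, y₀) :=
    (smoothFormAt_model_iff.1 hsm).differentiableAt (by simp)
  have hnat : extDeriv η (0, y₀) = pullback (actionFlow B A u) (extD Θ) (0, y₀) := by
    rw [← extD_model]
    exact extD_pullback (contMDiffAt_actionFlow B A hy) (hΘ _)
  have hinr : HasFDerivAt (fun y : EP => ((0 : ℝ), y)) (ContinuousLinearMap.inr ℝ ℝ EP) y₀ :=
    (ContinuousLinearMap.inr ℝ ℝ EP).hasFDerivAt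
  have hinl : HasDerivAt (fun t : ℝ => (t, y₀)) ((1 : ℝ), (0 : EP)) 0 :=
    (hasDerivAt_id (0 : ℝ)).prodMk (hasDerivAt_const (0 : ℝ) y₀)
  -- Expand `dη` on `(1, 0)` followed by spatial vectors: the time derivative gives `-D A (Θ u v)`,
  -- and the remaining terms will be minus those of `d (ι Θ)`.
  have key : ∀ v : Fin p → EP, iprod (B.fundamental A) (extD Θ) u v =
      -D A (Θ u v) + ∑ j : Fin p, (-1 : ℤ) ^ ((j : ℕ) + 1) •
        fderiv ℝ (fun q => η q (j.succ.removeNth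
          (Fin.cons ((1, 0) : ℝ × EP) fun i => (0, v i) : Fin (p + 1) → ℝ × EP))) (0, y₀)
          (0, v j) := by
    intro v
    have h1 : iprod (B.fundamental A) (extD Θ) u v =
        extDeriv η (0, y₀) (Fin.cons ((1, 0) : ℝ × EP) fun i => (0, v i)) := by
      rw [hnat, pullback_actionFlow_cons B A hy, hy₀, chartRep_self]
    rw [h1, extDeriv_apply hdiff, Fin.sum_univ_succ]
    congr 1
    have h2 : HasFDerivAt (fun q => η q fun i => (0, v i))
        (fderiv ℝ (fun q => η q fun i => (0, v i)) (0, y₀)) (0, y₀) :=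
      (hdiff.continuousAlternatingMap_apply_const _).hasFDerivAt
    have h3 := h2.comp_hasDerivAt (0 : ℝ) hinl
    -- Along the time axis, `η` on spatial vectors is the fixed value `Θ u v` acted on by `a
    -- (curveAt G A t)⁻¹`.
    have hev : (fun t : ℝ => a (curveAt G A t)⁻¹ (Θ u v)) =ᶠ[𝓝 0]
        (fun q => η q fun i => (0, v i)) ∘ fun t : ℝ => (t, y₀) := by
      filter_upwards [eventually_contMDiffAt (contMDiffAt_curveAt (G := G) A)] with t ht
      rw [← chartRep_self]
      exact (pullback_actionFlow_inr B A hy (ht.mdifferentiableAt one_ne_zero) heq v).symm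
    have h4 := (hasDerivAt_comp_curveAt_inv ha hD A).clm_apply (hasDerivAt_const (0 : ℝ) (Θ u v))
    have h5 := (h3.congr_of_eventuallyEq hev).unique h4
    simpa using h5
  ext v
  cases p with
  | zero => simpa [lieD] using key v
  | succ p =>
    have hrepi : ∀ w : Fin p → EP, (fun y => chartRep u (iprod (B.fundamental A) Θ) y w) =ᶠ[𝓝 y₀]
        fun y => η (0, y) (Fin.cons ((1, 0) : ℝ × EP) fun i => (0, w i)) := by
      intro w
      filter_upwards [eventually_mem_target (E := EP) u] with y hy
      exact (pullback_actionFlow_cons B A hy Θ w).symm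
    -- Differentiability of the contracted form is read off from `η`, so smoothness of `A^#` need
    -- not be shown.
    have hdr : DifferentiableAt ℝ (chartRep u (iprod (B.fundamental A) Θ)) y₀ := by
      have h1 : ContDiffAt ℝ 1 (fun y => (((η (0, y)).curryLeft (1, 0)).compContinuousLinearMap
          (ContinuousLinearMap.inr ℝ ℝ EP))) y₀ := by
        have h2 : ContDiffAt ℝ 1 (fun y : EP => η (0, y)) y₀ :=
          ((smoothFormAt_model_iff.1 hsm).of_le (by simp)).comp y₀ (by fun_prop)
        exact ContDiffAt.continuousAlternatingMap_compContinuousLinearMap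
          ((contDiff_curryLeft.contDiffAt.comp y₀ h2).clm_apply contDiffAt_const) contDiffAt_const
      refine (h1.congr_of_eventuallyEq ?_).differentiableAt one_ne_zero
      filter_upwards [eventually_mem_target (E := EP) u] with y hy
      ext w
      rw [← pullback_actionFlow_cons B A hy Θ w]
      refine congrArg (η (0, y)) (funext fun i => ?_)
      refine Fin.cases ?_ (fun j => ?_) i <;> simp
    -- The same derivatives as in `key`, but with sign `(-1) ^ j` in place of `(-1) ^ (j + 1)`;
    -- hence the sums cancel.
    have hext : extD (iprod (B.fundamental A) Θ) u v = ∑ j : Fin (p + 1), (-1 : ℤ) ^ (j : ℕ) •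
        fderiv ℝ (fun q => η q (j.succ.removeNth
          (Fin.cons ((1, 0) : ℝ × EP) fun i => (0, v i) : Fin (p + 2) → ℝ × EP))) (0, y₀)
          (0, v j) := by
      rw [extD_eq, extDeriv_apply hdr]
      refine Finset.sum_congr rfl fun j _ => ?_
      congr 1
      rw [removeNth_succ_cons, (hrepi _).fderiv_eq]
      have h2 : HasFDerivAt (fun q => η q (Fin.cons ((1, 0) : ℝ × EP)
          (j.removeNth fun i => ((0 : ℝ), v i)))) _ (0, y₀) :=
        (hdiff.continuousAlternatingMap_apply_const _).hasFDerivAt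
      have h3 := h2.comp y₀ hinr
      exact congrArg (fun B : EP →L[ℝ] V => B (v j)) h3.fderiv
    have hl : lieD (B.fundamental A) Θ u v = extD (iprod (B.fundamental A) Θ) u v +
      iprod (B.fundamental A) (extD Θ) u v := rfl
    rw [hl, hext, key]
    simp only [pow_succ, mul_neg_one, neg_smul, Finset.sum_neg_distrib]
    change _ = -(D A (Θ u v))
    abel

end LieDerivativeAlongAction

/-! ### The adjoint representation and its derivative -/

section Adjoint
variable {EG : Type*} [NormedAddCommGroup EG] [NormedSpace ℝ EG]
  (G : Type*) [TopologicalSpace G] [ChartedSpace EG G] [Group G] [LieGroup 𝓘(ℝ, EG) ∞ G]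

/-- The multiplication in the chart at `1`. -/
def chartMul (q : EG × EG) : EG :=
  extChartAt 𝓘(ℝ, EG) (1 : G)
    ((extChartAt 𝓘(ℝ, EG) (1 : G)).symm q.1 * (extChartAt 𝓘(ℝ, EG) (1 : G)).symm q.2)

/-- The derivative at `1` of left multiplication, in the chart at `1`. -/
def chartLeft (x : EG) : EG →L[ℝ] EG :=
  (fderiv ℝ (chartMul (EG := EG) G) (x, extChartAt 𝓘(ℝ, EG) (1 : G) 1)).comp
    (ContinuousLinearMap.inr ℝ EG EG)

/-- The derivative at `1` of right multiplication, in the chart at `1`. -/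
def chartRight (x : EG) : EG →L[ℝ] EG :=
  (fderiv ℝ (chartMul (EG := EG) G) (extChartAt 𝓘(ℝ, EG) (1 : G) 1, x)).comp
    (ContinuousLinearMap.inl ℝ EG EG)

theorem contMDiffAt_chartMul {x y : EG} (hx : x ∈ (extChartAt 𝓘(ℝ, EG) (1 : G)).target)
    (hy : y ∈ (extChartAt 𝓘(ℝ, EG) (1 : G)).target)
    (hxy : (extChartAt 𝓘(ℝ, EG) (1 : G)).symm x * (extChartAt 𝓘(ℝ, EG) (1 : G)).symm y ∈
      (chartAt EG (1 : G)).source) :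
    ContDiffAt ℝ ∞ (chartMul (EG := EG) G) (x, y) := by
  have h1 : ContMDiffAt 𝓘(ℝ, EG × EG) 𝓘(ℝ, EG) ∞
      (fun q : EG × EG => (extChartAt 𝓘(ℝ, EG) (1 : G)).symm q.1) (x, y) :=
    ContMDiffAt.comp (I' := 𝓘(ℝ, EG)) (x, y) (contMDiffAt_extChartAt_symm hx)
      contDiffAt_fst.contMDiffAt
  have h2 : ContMDiffAt 𝓘(ℝ, EG × EG) 𝓘(ℝ, EG) ∞
      (fun q : EG × EG => (extChartAt 𝓘(ℝ, EG) (1 : G)).symm q.2) (x, y) :=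
    ContMDiffAt.comp (I' := 𝓘(ℝ, EG)) (x, y) (contMDiffAt_extChartAt_symm hy)
      contDiffAt_snd.contMDiffAt
  exact ((contMDiffAt_extChartAt' hxy).comp (x, y) (h1.mul h2)).contDiffAt

theorem contMDiffAt_chartMul_one : ContDiffAt ℝ ∞ (chartMul (EG := EG) G)
    (extChartAt 𝓘(ℝ, EG) (1 : G) 1, extChartAt 𝓘(ℝ, EG) (1 : G) 1) :=
  contMDiffAt_chartMul G (mem_extChartAt_target _) (mem_extChartAt_target _) (by simp)

variable {G}

/-- As a function of `x` this is the left-invariant vector field of `A` in the chart at `1`, the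
form in which the Lie bracket is computed below. -/
theorem chartLeft_apply {x : EG} (hx : x ∈ (extChartAt 𝓘(ℝ, EG) (1 : G)).target) (A : EG) :
    chartLeft G x A = tmap (E := EG) (E' := EG) (extChartAt 𝓘(ℝ, EG) (1 : G))
      ((extChartAt 𝓘(ℝ, EG) (1 : G)).symm x)
      (tmap (E := EG) (E' := EG) (fun h => (extChartAt 𝓘(ℝ, EG) (1 : G)).symm x * h) 1 A) := by
  set φ := extChartAt 𝓘(ℝ, EG) (1 : G) with hφ
  have hs : φ.symm x ∈ (chartAt EG (1 : G)).source := by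
    simpa [hφ] using φ.map_target hx
  have hm : MDifferentiableAt 𝓘(ℝ, EG) 𝓘(ℝ, EG) (fun h : G => φ.symm x * h) 1 :=
    (contMDiff_mul_left (I := 𝓘(ℝ, EG)) (n := ∞)).mdifferentiableAt (by simp)
  have hch : MDifferentiableAt 𝓘(ℝ, EG) 𝓘(ℝ, EG) φ (φ.symm x * 1) := by
    rw [mul_one]
    exact mdifferentiableAt_extChartAt hs
  have hsym : MDifferentiableAt 𝓘(ℝ, EG) 𝓘(ℝ, EG) φ.symm (φ 1) :=
    (contMDiffAt_extChartAt_symm (n := ∞) (mem_extChartAt_target (1 : G))).mdifferentiableAt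
      (by simp)
  have h1 : φ.symm (φ 1) = 1 := extChartAt_to_inv (1 : G)
  have hm' := hch.comp 1 hm
  rw [← h1] at hm hm'
  have e := tmap_comp (E := EG) (E'' := EG) hm' hsym
  rw [h1] at e
  rw [tmap_comp (E := EG) (E'' := EG) (f := fun h : G => φ.symm x * h) hch (h1 ▸ hm), mul_one, tmap_eq_fderiv] at e
  have hd : DifferentiableAt ℝ (chartMul (EG := EG) G) (x, φ 1) :=
    (contMDiffAt_chartMul G hx (mem_extChartAt_target (1 : G)) (by
      rw [← hφ, h1, mul_one]; exact hs)).differentiableAt (by simp)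
  have hr : HasFDerivAt (fun y : EG => (x, y)) (ContinuousLinearMap.inr ℝ EG EG) (φ 1) :=
    hasFDerivAt_prodMk_right x (φ 1)
  have e2 := (hd.hasFDerivAt.comp (φ 1) hr).fderiv
  have e3 := congrArg (fun B : EG →L[ℝ] EG => B A) (e2.symm.trans e)
  refine e3.trans ?_
  simp only [ContinuousLinearMap.comp_apply]
  rw [hφ, tmap_extChartAt_symm_self]

theorem chartRight_apply {x : EG} (hx : x ∈ (extChartAt 𝓘(ℝ, EG) (1 : G)).target) (A : EG) :
    chartRight G x A = tmap (E := EG) (E' := EG) (extChartAt 𝓘(ℝ, EG) (1 : G))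
      ((extChartAt 𝓘(ℝ, EG) (1 : G)).symm x)
      (tmap (E := EG) (E' := EG) (fun h => h * (extChartAt 𝓘(ℝ, EG) (1 : G)).symm x) 1 A) := by
  set φ := extChartAt 𝓘(ℝ, EG) (1 : G) with hφ
  have hs : φ.symm x ∈ (chartAt EG (1 : G)).source := by
    simpa [hφ] using φ.map_target hx
  have hm : MDifferentiableAt 𝓘(ℝ, EG) 𝓘(ℝ, EG) (fun h : G => h * φ.symm x) 1 :=
    (contMDiff_mul_right (I := 𝓘(ℝ, EG)) (n := ∞)).mdifferentiableAt (by simp)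
  have hch : MDifferentiableAt 𝓘(ℝ, EG) 𝓘(ℝ, EG) φ (1 * φ.symm x) := by
    rw [one_mul]
    exact mdifferentiableAt_extChartAt hs
  have hsym : MDifferentiableAt 𝓘(ℝ, EG) 𝓘(ℝ, EG) φ.symm (φ 1) :=
    (contMDiffAt_extChartAt_symm (n := ∞) (mem_extChartAt_target (1 : G))).mdifferentiableAt
      (by simp)
  have h1 : φ.symm (φ 1) = 1 := extChartAt_to_inv (1 : G)
  have hm' := hch.comp 1 hm
  rw [← h1] at hm hm'
  have e := tmap_comp (E := EG) (E'' := EG) hm' hsym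
  rw [h1] at e
  rw [tmap_comp (E := EG) (E'' := EG) (f := fun h : G => h * φ.symm x) hch (h1 ▸ hm), one_mul, tmap_eq_fderiv] at e
  have hd : DifferentiableAt ℝ (chartMul (EG := EG) G) (φ 1, x) :=
    (contMDiffAt_chartMul G (mem_extChartAt_target (1 : G)) hx (by
      rw [← hφ, h1, one_mul]; exact hs)).differentiableAt (by simp)
  have hr : HasFDerivAt (fun y : EG => (y, x)) (ContinuousLinearMap.inl ℝ EG EG) (φ 1) :=
    hasFDerivAt_prodMk_left (φ 1) x
  have e2 := (hd.hasFDerivAt.comp (φ 1) hr).fderiv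
  have e3 := congrArg (fun B : EG →L[ℝ] EG => B A) (e2.symm.trans e)
  refine e3.trans ?_
  simp only [ContinuousLinearMap.comp_apply]
  rw [hφ, tmap_extChartAt_symm_self]

theorem chartLeft_one : chartLeft G (extChartAt 𝓘(ℝ, EG) (1 : G) 1) = ContinuousLinearMap.id ℝ EG := by
  ext A
  rw [chartLeft_apply (mem_extChartAt_target _)]
  simp only [extChartAt_to_inv, one_mul, tmap_id, tmap_extChartAt_self]
  rfl

theorem chartRight_one : chartRight G (extChartAt 𝓘(ℝ, EG) (1 : G) 1) = ContinuousLinearMap.id ℝ EG := by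
  ext A
  rw [chartRight_apply (mem_extChartAt_target _)]
  simp only [extChartAt_to_inv, mul_one, tmap_id, tmap_extChartAt_self]
  rfl

theorem Ad_one : Ad (EG := EG) (1 : G) = ContinuousLinearMap.id ℝ EG := by
  simp [Ad, tmap_id]

theorem contDiffAt_chartLeft : ContDiffAt ℝ ∞ (chartLeft (EG := EG) G) (extChartAt 𝓘(ℝ, EG) (1 : G) 1) := by
  have h := (contMDiffAt_chartMul_one (EG := EG) G).fderiv_right (m := ∞) (by simp)
  exact (h.comp (extChartAt 𝓘(ℝ, EG) (1 : G) 1)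
    (f := fun x => (x, extChartAt 𝓘(ℝ, EG) (1 : G) 1)) (by fun_prop)).clm_comp contDiffAt_const

theorem contDiffAt_chartRight : ContDiffAt ℝ ∞ (chartRight (EG := EG) G) (extChartAt 𝓘(ℝ, EG) (1 : G) 1) := by
  have h := (contMDiffAt_chartMul_one (EG := EG) G).fderiv_right (m := ∞) (by simp)
  exact (h.comp (extChartAt 𝓘(ℝ, EG) (1 : G) 1)
    (f := fun x => (extChartAt 𝓘(ℝ, EG) (1 : G) 1, x)) (by fun_prop)).clm_comp contDiffAt_const

/-- `(g h g⁻¹) g = g h`, differentiated in `h` at `1`. -/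
theorem chartRight_comp_Ad {x : EG} (hx : x ∈ (extChartAt 𝓘(ℝ, EG) (1 : G)).target) :
    (chartRight G x).comp (Ad ((extChartAt 𝓘(ℝ, EG) (1 : G)).symm x)) = chartLeft G x := by
  ext A
  rw [ContinuousLinearMap.comp_apply, chartRight_apply hx, chartLeft_apply hx]
  congr 1
  set g := (extChartAt 𝓘(ℝ, EG) (1 : G)).symm x
  have hr : ContMDiff 𝓘(ℝ, EG) 𝓘(ℝ, EG) ∞ (fun h : G => h * g) := contMDiff_mul_right
  have hl : ContMDiff 𝓘(ℝ, EG) 𝓘(ℝ, EG) ∞ (fun h : G => g * h * g⁻¹) :=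
    contMDiff_mul_right.comp contMDiff_mul_left
  have e := tmap_comp (E := EG) (x := (1 : G)) (hr.mdifferentiableAt (by simp))
    (hl.mdifferentiableAt (by simp))
  have hfun : (fun h : G => h * g) ∘ (fun h : G => g * h * g⁻¹) = fun h => g * h := by
    funext h; simp
  rw [hfun, mul_one, mul_inv_cancel] at e
  exact (congrArg (fun B : EG →L[ℝ] EG => B A) e).symm

/-- Both sides are the mixed second derivative of the multiplication at the identity, on `(0, A)`
and `(B, 0)`; the second derivative is symmetric. -/
theorem symm_chartMul_one (A B : EG) :
    fderiv ℝ (chartRight (EG := EG) G) (extChartAt 𝓘(ℝ, EG) (1 : G) 1) A B =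
      fderiv ℝ (chartLeft (EG := EG) G) (extChartAt 𝓘(ℝ, EG) (1 : G) 1) B A := by
  set x₀ := extChartAt 𝓘(ℝ, EG) (1 : G) 1
  have h := contMDiffAt_chartMul_one (EG := EG) G
  have hd : DifferentiableAt ℝ (fderiv ℝ (chartMul (EG := EG) G)) (x₀, x₀) :=
    (h.fderiv_right (m := ∞) (by simp)).differentiableAt (by simp)
  have h1 := ((hd.hasFDerivAt.comp x₀ (hasFDerivAt_prodMk_right x₀ x₀)).clm_comp
    (hasFDerivAt_const (ContinuousLinearMap.inl ℝ EG EG) x₀)).fderiv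
  have h2 := ((hd.hasFDerivAt.comp (f := fun y : EG => (y, x₀)) x₀ (hasFDerivAt_prodMk_left x₀ x₀)).clm_comp
    (hasFDerivAt_const (ContinuousLinearMap.inr ℝ EG EG) x₀)).fderiv
  have hs := (h.isSymmSndFDerivAt two_le_smooth) (0, A) (B, 0)
  refine (congrArg (fun T : EG →L[ℝ] EG →L[ℝ] EG => T A B) h1).trans (Eq.trans ?_
    (congrArg (fun T : EG →L[ℝ] EG →L[ℝ] EG => T B A) h2).symm)
  simpa [x₀] using hs

variable [FiniteDimensional ℝ EG]

/-- `chartRight` is the identity at the base point and invertibility is an open condition, so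
`chartRight_comp_Ad` can be solved for `Ad`. Smoothness of `Ad` at `1` follows from that of operator
inversion. -/
theorem Ad_chart_eventuallyEq : (fun x => Ad (EG := EG) ((extChartAt 𝓘(ℝ, EG) (1 : G)).symm x)) =ᶠ[𝓝
    (extChartAt 𝓘(ℝ, EG) (1 : G) 1)] fun x => (chartRight G x).inverse.comp (chartLeft G x) := by
  have hc : CompleteSpace EG := FiniteDimensional.complete ℝ EG
  have hu : ∀ᶠ x in 𝓝 (extChartAt 𝓘(ℝ, EG) (1 : G) 1), (chartRight (EG := EG) G x).IsInvertible := by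
    refine contDiffAt_chartRight.continuousAt.eventually ?_
    rw [chartRight_one]
    exact ContinuousLinearEquiv.nhds (ContinuousLinearEquiv.refl ℝ EG)
  filter_upwards [hu, eventually_mem_target (E := EG) (1 : G)] with x hx hxt
  obtain ⟨e, he⟩ := hx
  rw [← chartRight_comp_Ad hxt, ← he]
  ext A
  simp

theorem contDiffAt_Ad_chart : ContDiffAt ℝ ∞
    (fun x => Ad (EG := EG) ((extChartAt 𝓘(ℝ, EG) (1 : G)).symm x)) (extChartAt 𝓘(ℝ, EG) (1 : G) 1) := by
  have hc : CompleteSpace EG := FiniteDimensional.complete ℝ EG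
  refine ContDiffAt.congr_of_eventuallyEq ?_ Ad_chart_eventuallyEq
  refine ContDiffAt.clm_comp ?_ contDiffAt_chartLeft
  refine ContDiffAt.comp (g := ContinuousLinearMap.inverse) _ ?_ contDiffAt_chartRight
  rw [chartRight_one]
  exact contDiffAt_map_inverse (ContinuousLinearEquiv.refl ℝ EG)

theorem contMDiffAt_Ad : ContMDiffAt 𝓘(ℝ, EG) 𝓘(ℝ, EG →L[ℝ] EG) ∞ (fun g : G => Ad (EG := EG) g) 1 := by
  have h := ContMDiffAt.comp (1 : G) (contDiffAt_Ad_chart (EG := EG) (G := G)).contMDiffAt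
    (contMDiffAt_extChartAt (I := 𝓘(ℝ, EG)))
  refine h.congr_of_eventuallyEq ?_
  filter_upwards [(chartAt EG (1 : G)).open_source.mem_nhds (mem_chart_source EG (1 : G))] with g hg
  simp only [Function.comp_apply]
  rw [(extChartAt 𝓘(ℝ, EG) (1 : G)).left_inv (by simpa using hg)]

/-- Apply the product rule to `chartRight ∘ Ad = chartLeft` at the base point, where all three
factors are the identity, and trade the derivative of `chartRight` for that of `chartLeft` by
symmetry. -/
theorem tmap_Ad_apply (A B : EG) : tmap (E' := EG →L[ℝ] EG) (fun g : G => Ad (EG := EG) g) 1 A B =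
    fderiv ℝ (chartLeft (EG := EG) G) (extChartAt 𝓘(ℝ, EG) (1 : G) 1) A B -
      fderiv ℝ (chartLeft (EG := EG) G) (extChartAt 𝓘(ℝ, EG) (1 : G) 1) B A := by
  rw [tmap_eq_fderiv_inCharts (contMDiffAt_Ad.mdifferentiableAt (by simp))]
  have e : inCharts (E := EG) (E' := EG →L[ℝ] EG) (fun g : G => Ad (EG := EG) g) 1 =
    fun x => Ad (EG := EG) ((extChartAt 𝓘(ℝ, EG) (1 : G)).symm x) := rfl
  rw [e]
  have h1 : DifferentiableAt ℝ _ _ :=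
    (contDiffAt_Ad_chart (EG := EG) (G := G)).differentiableAt (by simp)
  have h2 : DifferentiableAt ℝ _ _ :=
    (contDiffAt_chartRight (EG := EG) (G := G)).differentiableAt (by simp)
  have h3 := (h2.hasFDerivAt.clm_comp h1.hasFDerivAt).fderiv
  have h4 : (fun x => (chartRight (EG := EG) G x).comp (Ad ((extChartAt 𝓘(ℝ, EG) (1 : G)).symm x)))
      =ᶠ[𝓝 (extChartAt 𝓘(ℝ, EG) (1 : G) 1)] chartLeft G := by
    filter_upwards [eventually_mem_target (E := EG) (1 : G)] with x hx
    exact chartRight_comp_Ad hx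
  rw [h4.fderiv_eq] at h3
  rw [chartRight_one, extChartAt_to_inv, Ad_one] at h3
  have h5 := congrArg (fun T : EG →L[ℝ] EG →L[ℝ] EG => T A B) h3
  rw [← symm_chartMul_one A B]
  refine eq_sub_of_add_eq (Eq.trans ?_ h5.symm)
  rfl

/-- The derived representation of `Ad` is the Lie bracket. -/
theorem tmap_Ad : tmap (E' := EG →L[ℝ] EG) (fun g : G => Ad (EG := EG) g) 1 = lieBr EG G := by
  ext A B
  rw [tmap_Ad_apply]
  set x₀ := extChartAt 𝓘(ℝ, EG) (1 : G) 1
  have hbr : lieBr EG G A B = VectorField.mlieBracket 𝓘(ℝ, EG)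
    (mulInvariantVectorField (I := 𝓘(ℝ, EG)) (G := G) A)
    (mulInvariantVectorField (I := 𝓘(ℝ, EG)) (G := G) B) 1 := rfl
  -- In the chart, left-invariant fields are `x ↦ chartLeft G x C`, so their bracket is the
  -- antisymmetrized derivative of `chartLeft`.
  have hX : ∀ C : EG, VectorField.mpullbackWithin 𝓘(ℝ, EG) 𝓘(ℝ, EG)
      (extChartAt 𝓘(ℝ, EG) (1 : G)).symm (mulInvariantVectorField (I := 𝓘(ℝ, EG)) (G := G) C)
      (range 𝓘(ℝ, EG)) =ᶠ[𝓝 x₀] fun x => chartLeft G x C := by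
    intro C
    filter_upwards [eventually_mem_target (E := EG) (1 : G)] with x hx
    rw [chartLeft_apply hx, VectorField.mpullbackWithin_apply, ContinuousLinearMap.inverse_eq
      (mfderivWithin_extChartAt_symm_comp_mfderiv_extChartAt (I := 𝓘(ℝ, EG)) hx)
      (mfderiv_extChartAt_comp_mfderivWithin_extChartAt_symm (I := 𝓘(ℝ, EG)) hx)]
    rfl
  have hL : DifferentiableAt ℝ (chartLeft (EG := EG) G) x₀ :=
    contDiffAt_chartLeft.differentiableAt (by simp)
  have hf : ∀ C D : EG, fderiv ℝ (fun x => chartLeft G x C) x₀ D =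
      fderiv ℝ (chartLeft (EG := EG) G) x₀ D C := by
    intro C D
    rw [fderiv_clm_apply hL (by fun_prop)]
    simp
  rw [hbr, ← VectorField.mlieBracketWithin_univ, VectorField.mlieBracketWithin_apply]
  -- The bracket is transported back by the inverse of the derivative of the chart at its own base
  -- point, which is the identity.
  have hinv : ∀ T : EG →L[ℝ] EG, T = ContinuousLinearMap.id ℝ EG → ∀ v, T.inverse v = v := by
    rintro _ rfl v
    simp
  refine Eq.trans ?_ (hinv _ (mfderiv_extChartAt_self (I := 𝓘(ℝ, EG)) (x := (1 : G))) _).symm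
  simp only [preimage_univ, univ_inter, ModelWithCorners.range_eq_univ] at hX ⊢
  refine Eq.trans ?_ (congrFun VectorField.lieBracketWithin_univ x₀).symm
  refine Eq.trans ?_ ((hX A).lieBracket_vectorField_eq (𝕜 := ℝ) (hX B)).symm
  rw [VectorField.lieBracket_eq]
  simp only [hf, chartLeft_one, x₀]
  rfl

end Adjoint

theorem SmoothFormAt.compContinuousAlternatingMap_variable
    {E : Type*} [NormedAddCommGroup E] [NormedSpace ℝ E]
    {M : Type*} [TopologicalSpace M] [ChartedSpace E M] [IsManifold 𝓘(ℝ, E) ∞ M]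
    {V : Type*} [NormedAddCommGroup V] [NormedSpace ℝ V] {p : ℕ}
    {A : M → V →L[ℝ] V} {θ : Form E M p V} {x : M}
    (hA : ContMDiffAt 𝓘(ℝ, E) 𝓘(ℝ, V →L[ℝ] V) ∞ A x) (hθ : SmoothFormAt θ x) :
    SmoothFormAt (fun y => (A y).compContinuousAlternatingMap (θ y)) x := by
  have h : ContDiffAt ℝ ∞ (fun y => A ((extChartAt 𝓘(ℝ, E) x).symm y)) (extChartAt 𝓘(ℝ, E) x x) :=
    (ContMDiffAt.comp_of_eq (I' := 𝓘(ℝ, E)) hA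
      (contMDiffAt_extChartAt_symm (mem_extChartAt_target x)) (extChartAt_to_inv x)).contDiffAt
  exact ContDiffAt.compContinuousAlternatingMap h hθ

/-! ### Vertical vectors, sections and the correspondence with tensorial forms -/

namespace PrincipalBundle
section
variable {EX : Type*} [NormedAddCommGroup EX] [NormedSpace ℝ EX]
  {X : Type*} [TopologicalSpace X] [ChartedSpace EX X] [IsManifold 𝓘(ℝ, EX) ∞ X]
  {EG : Type*} [NormedAddCommGroup EG] [NormedSpace ℝ EG]
  {G : Type*} [TopologicalSpace G] [ChartedSpace EG G] [Group G] [LieGroup 𝓘(ℝ, EG) ∞ G]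
  {EP : Type*} [NormedAddCommGroup EP] [NormedSpace ℝ EP]
  {P : Type*} [TopologicalSpace P] [ChartedSpace EP P] [IsManifold 𝓘(ℝ, EP) ∞ P]
  {V : Type*} [NormedAddCommGroup V] [NormedSpace ℝ V] {p : ℕ}
  (B : PrincipalBundle EX X EG G EP P)

theorem contMDiff_act_right (g : G) : ContMDiff 𝓘(ℝ, EP) 𝓘(ℝ, EP) ∞ (fun u => B.act u g) :=
  B.act_smooth.comp (contMDiff_id.prodMk contMDiff_const)

theorem contMDiff_act_left (u : P) : ContMDiff 𝓘(ℝ, EG) 𝓘(ℝ, EP) ∞ (fun g => B.act u g) :=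
  B.act_smooth.comp (contMDiff_const.prodMk contMDiff_id)

theorem tmap_proj_act (g : G) (u : P) (v : EP) :
    tmap (E' := EX) B.proj (B.act u g) (tmap (E' := EP) (fun w => B.act w g) u v) =
      tmap (E' := EX) B.proj u v := by
  have h := tmap_comp (E := EP) (x := u) ((B.proj_smooth _).mdifferentiableAt (by simp))
    ((B.contMDiff_act_right g u).mdifferentiableAt (by simp))
  have e : B.proj ∘ (fun w => B.act w g) = B.proj := funext fun w => B.proj_act w g
  rw [e] at h
  exact (congrArg (fun T : EP →L[ℝ] EX => T v) h).symm

theorem tmap_proj_fundamental (A : EG) (u : P) :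
    tmap (E' := EX) B.proj u (B.fundamental A u) = 0 := by
  have h := tmap_comp (E := EG) (x := (1 : G)) ((B.proj_smooth _).mdifferentiableAt (by simp))
    ((B.contMDiff_act_left u 1).mdifferentiableAt (by simp))
  have e : B.proj ∘ (fun g => B.act u g) = fun _ => B.proj u := funext fun g => B.proj_act u g
  rw [e, tmap_const, B.act_one] at h
  exact (congrArg (fun T : EG →L[ℝ] EX => T A) h).symm

/-- Differentiate `w = e.symm (proj w, (e w).2)` in a local trivialization. The base contribution
vanishes on a vertical vector, and the fibre contribution factors through the orbit map of `u`. -/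
theorem exists_fundamental_eq {u : P} {v : EP} (hv : tmap (E' := EX) B.proj u v = 0) :
    ∃ A : EG, B.fundamental A u = v := by
  obtain ⟨U, e, hU, hxU, hs, ht, hes, het, he1, he2⟩ := B.locally_trivial (B.proj u)
  have hu : u ∈ e.source := by rw [hs]; exact hxU
  have hesm := (hes.contMDiffAt (e.open_source.mem_nhds hu)).mdifferentiableAt (by simp)
  have hc : MDifferentiableAt 𝓘(ℝ, EP) 𝓘(ℝ, EG) (fun w => (e w).2) u := hesm.snd
  have htar : (B.proj u, (e u).2) ∈ e.target := by rw [ht]; exact ⟨hxU, mem_univ _⟩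
  have hsymm := (het.contMDiffAt (e.open_target.mem_nhds htar)).mdifferentiableAt (by simp)
  have h := tmap_two_variables (f := fun x g => e.symm (x, g)) hsymm
    ((B.proj_smooth u).mdifferentiableAt (by simp)) hc v
  have hid : (fun w => e.symm (B.proj w, (e w).2)) =ᶠ[𝓝 u] fun w => w := by
    filter_upwards [e.open_source.mem_nhds hu] with w hw
    rw [← he1 w hw]
    exact e.left_inv hw
  rw [tmap_congr hid, tmap_id, hv, map_zero, zero_add] at h
  have hact : (fun g => e.symm (B.proj u, g)) =
      (fun g => B.act u g) ∘ fun g => (e u).2⁻¹ * g := by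
    funext g
    have hw : B.act u ((e u).2⁻¹ * g) ∈ e.source := by
      rw [hs, mem_preimage, B.proj_act]; exact hxU
    have := he2 u hu ((e u).2⁻¹ * g)
    rw [mul_inv_cancel_left, he1 u hu] at this
    rw [← this]
    exact e.left_inv hw
  rw [hact, tmap_comp ((B.contMDiff_act_left u _).mdifferentiableAt (by simp))
    (((contMDiff_mul_left (I := 𝓘(ℝ, EG)) (n := ∞)).mdifferentiableAt (by simp)))] at h
  rw [ContinuousLinearMap.comp_apply, inv_mul_cancel] at h
  exact ⟨_, h.symm⟩

theorem exists_section (u : P) :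
    ∃ σ : B.LocalSection, B.proj u ∈ σ.dom ∧ σ.toFun (B.proj u) = u := by
  obtain ⟨U, e, hU, hxU, hs, ht, hes, het, he1, he2⟩ := B.locally_trivial (B.proj u)
  have hu : u ∈ e.source := by rw [hs]; exact hxU
  have htar : ∀ x ∈ U, ∀ g, (x, g) ∈ e.target := fun x hx g => by rw [ht]; exact ⟨hx, mem_univ _⟩
  refine ⟨⟨U, hU, fun x => e.symm (x, (e u).2), ?_, ?_⟩, hxU, ?_⟩
  · exact het.comp (contMDiffOn_id.prodMk contMDiffOn_const) fun x hx => htar x hx _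
  · intro x hx
    rw [← he1 _ (e.map_target (htar x hx _)), e.right_inv (htar x hx _)]
  · change e.symm (B.proj u, (e u).2) = u
    rw [← he1 u hu]
    exact e.left_inv hu

theorem LocalSection.contMDiffAt {B : PrincipalBundle EX X EG G EP P} (σ : B.LocalSection) {x : X}
    (hx : x ∈ σ.dom) : ContMDiffAt 𝓘(ℝ, EX) 𝓘(ℝ, EP) ∞ σ.toFun x :=
  σ.smooth.contMDiffAt (σ.isOpen_dom.mem_nhds hx)

theorem LocalSection.tmap_proj {B : PrincipalBundle EX X EG G EP P} (σ : B.LocalSection) {x : X}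
    (hx : x ∈ σ.dom) (v : EX) :
    tmap (E' := EX) B.proj (σ.toFun x) (tmap (E' := EP) σ.toFun x v) = v := by
  have h := tmap_comp (E := EX) (x := x) ((B.proj_smooth _).mdifferentiableAt (by simp))
    ((σ.contMDiffAt hx).mdifferentiableAt (by simp))
  have hid : B.proj ∘ σ.toFun =ᶠ[𝓝 x] fun y => y := by
    filter_upwards [σ.isOpen_dom.mem_nhds hx] with y hy
    exact σ.proj_toFun y hy
  rw [tmap_congr hid, tmap_id] at h
  exact (congrArg (fun T : EX →L[ℝ] EX => T v) h).symm

/-- Near a point over the domain of `σ`, the bundle is smoothly parametrized by `σ` and `G`. -/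
theorem LocalSection.exists_gauge {B : PrincipalBundle EX X EG G EP P} (σ : B.LocalSection) {u : P}
    (hu : B.proj u ∈ σ.dom) :
    ∃ γ : P → G, ContMDiffAt 𝓘(ℝ, EP) 𝓘(ℝ, EG) ∞ γ u ∧
      ∀ᶠ w in 𝓝 u, w = B.act (σ.toFun (B.proj w)) (γ w) := by
  obtain ⟨U, e, hU, hxU, hs, ht, hes, het, he1, he2⟩ := B.locally_trivial (B.proj u)
  have hmem : ∀ w, B.proj w ∈ U → w ∈ e.source := fun w hw => by rw [hs]; exact hw
  have hes' : ∀ w, B.proj w ∈ U → ContMDiffAt 𝓘(ℝ, EP) 𝓘(ℝ, EG) ∞ (fun z => (e z).2) w :=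
    fun w hw => (hes.contMDiffAt (e.open_source.mem_nhds (hmem w hw))).snd
  have hσ : B.proj (σ.toFun (B.proj u)) = B.proj u := σ.proj_toFun _ hu
  -- In a trivialization, the element carrying `σ` to `w` is the quotient of the two fibre
  -- coordinates.
  refine ⟨fun w => (e (σ.toFun (B.proj w))).2⁻¹ * (e w).2, ?_, ?_⟩
  · refine ContMDiffAt.mul (ContMDiffAt.inv ?_) (hes' u hxU)
    exact ContMDiffAt.comp (I' := 𝓘(ℝ, EP)) (g := fun z => (e z).2)
      (f := fun w => σ.toFun (B.proj w)) u (hes' _ (by rw [hσ]; exact hxU))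
      ((σ.contMDiffAt hu).comp u (B.proj_smooth u))
  · have hcont : ContinuousAt B.proj u := (B.proj_smooth u).continuousAt
    filter_upwards [hcont.eventually (σ.isOpen_dom.mem_nhds hu),
      hcont.eventually (hU.mem_nhds hxU)] with w hw hwU
    have hσw := σ.proj_toFun _ hw
    have h1 : σ.toFun (B.proj w) ∈ e.source := hmem _ (by rw [hσw]; exact hwU)
    refine e.injOn (hmem w hwU) (hmem _ (by rw [B.proj_act, hσw]; exact hwU)) ?_
    rw [he2 _ h1, mul_inv_cancel_left, he1 _ h1, hσw, ← he1 w (hmem w hwU)]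

variable {B}

/-- Horizontality on fundamental vector fields in the first slot suffices. -/
theorem horizontal_of_fundamental {Θ : Form EP P (p + 1) V} {u : P}
    (h : ∀ A : EG, iprod (B.fundamental A) Θ u = 0) (v : Fin (p + 1) → EP)
    (hv : ∃ i, tmap (E' := EX) B.proj u (v i) = 0) : Θ u v = 0 := by
  obtain ⟨i, hi⟩ := hv
  obtain ⟨A, hA⟩ := B.exists_fundamental_eq hi
  -- Move the vertical argument to the first slot; this costs only a sign.
  have h0 : Θ u (v ∘ Equiv.swap 0 i) = 0 := by
    have := congrArg (fun θ => θ (Fin.tail (v ∘ Equiv.swap 0 i))) (h A)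
    simp only [iprod_apply, hA] at this
    have e : v i = (v ∘ Equiv.swap 0 i) 0 := by simp
    rw [e, Fin.cons_self_tail] at this
    exact this
  rcases eq_or_ne 0 i with rfl | hne
  · simpa using h0
  · exact neg_eq_zero.1 (((Θ u).toAlternatingMap.map_swap v hne).symm.trans h0)

/-- A horizontal form only depends on the projections of its arguments. -/
theorem horizontal_congr {θ : EP [⋀^Fin p]→L[ℝ] V} {T : EP →L[ℝ] EX}
    (h : ∀ v : Fin p → EP, (∃ i, T (v i) = 0) → θ v = 0) {v w : Fin p → EP}
    (hvw : ∀ i, T (v i) = T (w i)) : θ v = θ w := by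
  classical
  -- Exchange the arguments one at a time: each exchange changes the value by a term with a vertical
  -- argument.
  have key : ∀ s : Finset (Fin p), θ (fun i => if i ∈ s then w i else v i) = θ v := by
    intro s
    induction s using Finset.induction_on with
    | empty => simp
    | insert j s hj ih =>
      rw [← ih, ← sub_eq_zero]
      set b : Fin p → EP := fun i => if i ∈ s then w i else v i
      have e1 : (fun i => if i ∈ insert j s then w i else v i) = Function.update b j (w j) := by
        funext i
        by_cases hij : i = j
        · subst hij; simp
        · simp [hij, b]
      have e2 : b = Function.update b j (v j) := by
        funext i
        by_cases hij : i = j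
        · subst hij; simp [b, hj]
        · simp [hij]
      rw [e1]
      nth_rewrite 2 [e2]
      rw [← ContinuousAlternatingMap.map_update_sub]
      exact h _ ⟨j, by simp [hvw j]⟩
  simpa using (key Finset.univ).symm

/-- For `τ(x) = σ(x) · g` the vectors `dτ(v)` and `dρ_g(dσ(v))` have the same projection, so a
horizontal form does not distinguish them. Hence only the value of the gauge transformation at `x`
matters, not its derivative. -/
theorem IsTensorial.corresponds {a : G → V →L[ℝ] V} {Θ : Form EP P p V} (h : B.IsTensorial a Θ) :
    B.Corresponds a (B.localReps Θ) Θ := by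
  refine ⟨⟨fun σ => ?_, ?_⟩, h, fun _ _ _ => rfl⟩
  · rw [smoothFormOn_iff σ.isOpen_dom]
    exact fun x hx => (smoothFormOn_univ_iff.1 h.smooth _).pullback (σ.contMDiffAt hx)
  · intro σ τ x hσ hτ g hg
    ext v
    have h2 := congrArg (fun θ => θ fun i => tmap (E' := EP) σ.toFun x (v i))
      (h.equivariant g (σ.toFun x))
    refine Eq.trans ?_ h2
    simp only [localReps, pullback_apply, hg]
    refine horizontal_congr (T := tmap (E' := EX) B.proj (B.act (σ.toFun x) g))
      (h.horizontal _) fun i => ?_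
    rw [tmap_proj_act, σ.tmap_proj hσ, ← hg, τ.tmap_proj hτ]

/-- The compatibility rule makes the chosen section irrelevant. As `σ` need not pass through `u`,
one section describes the form on a whole neighbourhood, with `g` varying. -/
theorem totalForm_eq {a : G → V →L[ℝ] V} {φ : B.LocalFamily p V} (h : B.IsAssociatedForm a φ)
    (σ : B.LocalSection) {u : P} (hu : B.proj u ∈ σ.dom) {g : G}
    (hg : u = B.act (σ.toFun (B.proj u)) g) :
    B.totalForm φ u = (a g⁻¹).compContinuousAlternatingMap (pullback B.proj (φ σ) u) := by
  have hex := B.exists_section u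
  rw [totalForm, dif_pos hex, h.compat σ hex.choose _ hu hex.choose_spec.1 g
    (hex.choose_spec.2.trans hg)]
  rfl

-- Smoothness comes from writing the form with one section and the smooth gauge function of
-- `exists_gauge`; horizontality holds because arguments enter only through `d proj`; equivariance
-- compares `g` with `1` in `totalForm_eq`.
variable [FiniteDimensional ℝ EG] in
theorem IsAssociatedForm.isTensorial {r : SmoothRep EG G V} {φ : B.LocalFamily p V}
    (h : B.IsAssociatedForm r.toHom φ) : B.IsTensorial r.toHom (B.totalForm φ) := by
  refine ⟨smoothFormOn_univ_iff.2 fun u => ?_, fun u v hv => ?_, fun g u => ?_⟩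
  · obtain ⟨σ, hσ, -⟩ := B.exists_section u
    obtain ⟨γ, hγ, hact⟩ := σ.exists_gauge hσ
    have hsm : SmoothFormAt (fun w => (r.toHom (γ w)⁻¹).compContinuousAlternatingMap
        (pullback (E := EP) B.proj (φ σ) w)) u := by
      refine SmoothFormAt.compContinuousAlternatingMap_variable ?_ ?_
      · exact r.smooth.contMDiffAt.comp u hγ.inv
      · exact ((smoothFormOn_iff σ.isOpen_dom).1 (h.smooth σ) _ hσ).pullback (B.proj_smooth u)
    refine hsm.congr ?_
    filter_upwards [hact, (B.proj_smooth u).continuousAt.eventually (σ.isOpen_dom.mem_nhds hσ)]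
      with w hw hwσ
    exact totalForm_eq h σ hwσ hw
  · obtain ⟨σ, hσ, hu⟩ := B.exists_section u
    rw [totalForm_eq h σ hσ (g := 1) (by rw [hu, B.act_one])]
    obtain ⟨i, hi⟩ := hv
    simp only [ContinuousLinearMap.compContinuousAlternatingMap_coe, Function.comp_apply,
      pullback_apply]
    rw [(φ σ (B.proj u)).map_coord_zero i hi, map_zero]
  · obtain ⟨σ, hσ, hu⟩ := B.exists_section u
    have hp := B.proj_act u g
    ext v
    rw [pullback_apply, totalForm_eq h σ (u := B.act u g) (by rw [hp]; exact hσ) (g := g)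
      (by rw [hp, hu]), totalForm_eq h σ hσ (g := 1) (by rw [hu, B.act_one])]
    simp only [ContinuousLinearMap.compContinuousAlternatingMap_coe, Function.comp_apply,
      pullback_apply, tmap_proj_act, hp, inv_one, map_one, one_apply_eq_self]

variable [FiniteDimensional ℝ EG] in
theorem IsAssociatedForm.corresponds {r : SmoothRep EG G V} {φ : B.LocalFamily p V}
    (h : B.IsAssociatedForm r.toHom φ) : B.Corresponds r.toHom φ (B.totalForm φ) := by
  refine ⟨h, h.isTensorial, fun σ x hx => ?_⟩
  have hp := σ.proj_toFun x hx
  ext v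
  rw [localReps, pullback_apply, totalForm_eq h σ (g := 1) (by rw [hp]; exact hx)
    (by rw [hp, B.act_one])]
  simp only [ContinuousLinearMap.compContinuousAlternatingMap_coe, Function.comp_apply,
    pullback_apply, σ.tmap_proj hx, hp, inv_one, map_one, one_apply_eq_self]

end
end PrincipalBundle

/-! ### Naturality and locality of covariant derivatives and curvature -/

section Naturality
variable {E : Type*} [NormedAddCommGroup E] [NormedSpace ℝ E]
  {M : Type*} [TopologicalSpace M] [ChartedSpace E M] [IsManifold 𝓘(ℝ, E) ∞ M]
  {E' : Type*} [NormedAddCommGroup E'] [NormedSpace ℝ E']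
  {N : Type*} [TopologicalSpace N] [ChartedSpace E' N] [IsManifold 𝓘(ℝ, E') ∞ N]
  {V : Type*} [NormedAddCommGroup V] [NormedSpace ℝ V]
  {W : Type*} [NormedAddCommGroup W] [NormedSpace ℝ W]
  {p : ℕ}

theorem covD_pullback {f : M → N} {x : M} (hf : ContMDiffAt 𝓘(ℝ, E) 𝓘(ℝ, E') ∞ f x)
    (a : W →L[ℝ] V →L[ℝ] V) (α : Form E' N 1 W) {θ : Form E' N p V} (hθ : SmoothFormAt θ (f x)) :
    covD a (pullback f α) (pullback (E := E) f θ) x = pullback f (covD a α θ) x := by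
  have e : pullback (E := E) f (covD a α θ) x =
    pullback f (extD θ) x + pullback f (wedge a α θ) x := rfl
  rw [e, ← extD_pullback hf hθ, pullback_wedge]
  rfl

theorem covD_congr (a : W →L[ℝ] V →L[ℝ] V) (α : Form E M 1 W) {θ θ' : Form E M p V} {x : M}
    (h : θ =ᶠ[𝓝 x] θ') : covD a α θ x = covD a α θ' x := by
  have e : wedge a α θ x = wedge a α θ' x := by
    simp only [wedge, h.eq_of_nhds]
  simp only [covD, Pi.add_apply, extD_congr h, e]

theorem covDInterior_congr (a : W →L[ℝ] V →L[ℝ] V) (α : Form E M 1 W) (Z : M → E)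
    {θ θ' : Form E M p V} {x : M} (h : θ =ᶠ[𝓝 x] θ') :
    covDInterior a α Z θ x = covDInterior a α Z θ' x := by
  cases p with
  | zero => rfl
  | succ p =>
    refine covD_congr a α ?_
    filter_upwards [h] with y hy
    simp only [iprod, hy]

theorem curvature_pullback {EG : Type*} [NormedAddCommGroup EG] [NormedSpace ℝ EG]
    [FiniteDimensional ℝ EG] (G : Type*) [TopologicalSpace G] [ChartedSpace EG G] [Group G]
    [LieGroup 𝓘(ℝ, EG) ∞ G] {f : M → N} {x : M} (hf : ContMDiffAt 𝓘(ℝ, E) 𝓘(ℝ, E') ∞ f x)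
    {α : Form E' N 1 EG} (hα : SmoothFormAt α (f x)) :
    curvature G (pullback (E := E) f α) x = pullback f (curvature G α) x := by
  have e : pullback (E := E) f (curvature G α) x =
    pullback f (extD α) x + (1 / 2 : ℝ) • pullback f (wedge (lieBr EG G) α α) x := rfl
  rw [e, ← extD_pullback hf hα, pullback_wedge]
  rfl

end Naturality

theorem lieBr_skew {EG : Type*} [NormedAddCommGroup EG] [NormedSpace ℝ EG]
    [FiniteDimensional ℝ EG] (G : Type*) [TopologicalSpace G] [ChartedSpace EG G] [Group G]
    [LieGroup 𝓘(ℝ, EG) ∞ G] (A B : EG) : lieBr EG G A B = -lieBr EG G B A := by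
  rw [← tmap_Ad, tmap_Ad_apply, tmap_Ad_apply, neg_sub]

/-! ### Horizontality and descent to the base -/

namespace PrincipalBundle
section
variable {EX : Type*} [NormedAddCommGroup EX] [NormedSpace ℝ EX]
  {X : Type*} [TopologicalSpace X] [ChartedSpace EX X] [IsManifold 𝓘(ℝ, EX) ∞ X]
  {EG : Type*} [NormedAddCommGroup EG] [NormedSpace ℝ EG] [FiniteDimensional ℝ EG]
  {G : Type*} [TopologicalSpace G] [ChartedSpace EG G] [Group G] [LieGroup 𝓘(ℝ, EG) ∞ G]
  {EP : Type*} [NormedAddCommGroup EP] [NormedSpace ℝ EP]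
  {P : Type*} [TopologicalSpace P] [ChartedSpace EP P] [IsManifold 𝓘(ℝ, EP) ∞ P]
  {V : Type*} [NormedAddCommGroup V] [NormedSpace ℝ V] {p : ℕ}
  {B : PrincipalBundle EX X EG G EP P}

/-- A form on `P` vanishing whenever one of its arguments is vertical. -/
def IsHorizontal (B : PrincipalBundle EX X EG G EP P) (Θ : Form EP P p V) : Prop :=
  ∀ (u : P) (v : Fin p → EP), (∃ i, tmap (E' := EX) B.proj u (v i) = 0) → Θ u v = 0

theorem IsHorizontal.iprod {Θ : Form EP P (p + 1) V} (h : B.IsHorizontal Θ) (Z : P → EP) :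
    B.IsHorizontal (CovLie.iprod Z Θ) := by
  rintro u v ⟨i, hi⟩
  exact h u _ ⟨i.succ, by simpa using hi⟩

theorem IsHorizontal.wedgeZero {W : Type*} [NormedAddCommGroup W] [NormedSpace ℝ W]
    {Θ : Form EP P p V} (h : B.IsHorizontal Θ) (a : W →L[ℝ] V →L[ℝ] V) (l : Form EP P 0 W) :
    B.IsHorizontal (CovLie.wedgeZero a l Θ) := by
  intro u v hv
  rw [wedgeZero_apply, h u v hv, map_zero]

theorem Connection.iprod_fundamental (w : B.Connection) (A : EG) (u : P)
    (v : Fin 0 → EP) : iprod (B.fundamental A) w.form u v = A := by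
  rw [iprod_apply]
  refine Eq.trans (congrArg (w.form u) (funext fun i => ?_)) (w.fundamental A u)
  refine Fin.cases ?_ (fun j => j.elim0) i
  rfl

/-- The covariant derivative of a tensorial form is horizontal. -/
theorem IsTensorial.isHorizontal_covD {a : G → V →L[ℝ] V} {D : EG →L[ℝ] V →L[ℝ] V}
    (ha : MDifferentiableAt 𝓘(ℝ, EG) 𝓘(ℝ, V →L[ℝ] V) a 1) (hD : tmap a 1 = D)
    {Θ : Form EP P p V} (h : B.IsTensorial a Θ) (w : B.Connection) :
    B.IsHorizontal (covD D w.form Θ) := by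
  intro u
  refine horizontal_of_fundamental fun A => ?_
  -- Compare two values of `L_{A^#} Θ`: equivariance gives `-A · Θ`, and `lieD_eq_covD` gives
  -- `ι_{A^#} d^ω Θ - A · Θ`, as `ι_{A^#} Θ = 0` and `ω(A^#) = A`.
  have h1 := lieD_fundamental B A (smoothFormOn_univ_iff.1 h.smooth) ha hD h.equivariant u
  have h2 := congrFun (lieD_eq_covD (B.fundamental A) D w.form Θ) u
  have h3 : covDInterior D w.form (B.fundamental A) Θ u = 0 := by
    cases p with
    | zero => rfl
    | succ p =>
      have h4 : iprod (B.fundamental A) Θ = 0 := by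
        funext u
        ext v
        exact h.horizontal u _ ⟨0, B.tmap_proj_fundamental A u⟩
      simp only [covDInterior, covD, h4, Pi.add_apply, extD_zero]
      ext v
      rw [zero_add, wedge_apply]
      simp
  have h5 : wedgeZero D (iprod (B.fundamental A) w.form) Θ u =
      (D A).compContinuousAlternatingMap (Θ u) := by
    ext v
    rw [wedgeZero_apply, w.iprod_fundamental]
    rfl
  rw [h1] at h2
  simp only [Pi.add_apply, Pi.sub_apply, h3, h5, add_zero] at h2
  rw [eq_sub_iff_add_eq, neg_add_cancel] at h2
  exact h2.symm

/-- The curvature form is horizontal. -/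
theorem Connection.isHorizontal_curvature (w : B.Connection) :
    B.IsHorizontal (curvature G w.form) := by
  intro u
  refine horizontal_of_fundamental fun A => ?_
  -- Here `L_{A^#} ω = -[A, ω]`, while the covariant derivative of the constant function `A` is `[ω,
  -- A] = -[A, ω]`; what remains of `lieD_one_form` is `ι_{A^#} F_ω = 0`.
  have h1 := lieD_fundamental B A (smoothFormOn_univ_iff.1 w.smooth)
    (contMDiffAt_Ad.mdifferentiableAt (by simp)) tmap_Ad w.equivariant u
  have h2 := congrFun (lieD_one_form (B.fundamental A) (lieBr_skew G) w.form) u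
  have h3 : iprod (B.fundamental A) w.form =
      fun _ => ContinuousAlternatingMap.constOfIsEmpty ℝ EP (Fin 0) A := by
    funext u
    ext v
    exact w.iprod_fundamental A u v
  have h4 : wedgeZero (lieBr EG G) (iprod (B.fundamental A) w.form) w.form u =
      (lieBr EG G A).compContinuousAlternatingMap (w.form u) := by
    ext v
    rw [wedgeZero_apply, w.iprod_fundamental]
    rfl
  have h5 : covD (lieBr EG G) w.form (iprod (B.fundamental A) w.form) u =
      -(lieBr EG G A).compContinuousAlternatingMap (w.form u) := by
    rw [← h4, wedgeZero_eq_neg_wedge (lieBr_skew G), covD, h3, Pi.add_apply, extD_const,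
      Pi.neg_apply, neg_neg]
    exact zero_add _
  rw [h1, Pi.add_apply, h5] at h2
  exact left_eq_add.1 (h2.trans (add_comm _ _))

variable {L : B.InvariantLift} {ξ : VecField EX X}

theorem IsTensorial.iprod_lift {a : G → V →L[ℝ] V} {Θ : Form EP P (p + 1) V}
    (h : B.IsTensorial a Θ) (L : B.InvariantLift) (ξ : VecField EX X) :
    B.IsTensorial a (iprod (L.lift ξ).val Θ) := by
  refine ⟨smoothFormOn_univ_iff.2 fun u => ?_, IsHorizontal.iprod h.horizontal _, fun g u => ?_⟩
  · exact (smoothFormOn_univ_iff.1 h.smooth u).iprod ((L.lift ξ).smoothVecAt u)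
  · rw [pullback_iprod (L.invariant ξ g u)]
    ext v
    simp only [iprod_apply, h.equivariant g u]
    rfl

theorem InvariantLift.lamTotal_isTensorial (L : B.InvariantLift) (w : B.Connection)
    (ξ : VecField EX X) : B.IsTensorial Ad (L.lamTotal w ξ) := by
  refine ⟨smoothFormOn_univ_iff.2 fun u => ?_, fun u v hv => hv.choose.elim0, fun g u => ?_⟩
  · exact (smoothFormOn_univ_iff.1 w.smooth u).iprod ((L.lift ξ).smoothVecAt u)
  · rw [lamTotal, pullback_iprod (L.invariant ξ g u)]
    ext v
    simp only [iprod_apply, w.equivariant g u]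
    rfl

theorem isHorizontal_covDInterior {a : G → V →L[ℝ] V} {D : EG →L[ℝ] V →L[ℝ] V}
    (ha : MDifferentiableAt 𝓘(ℝ, EG) 𝓘(ℝ, V →L[ℝ] V) a 1) (hD : tmap a 1 = D)
    {Θ : Form EP P p V} (h : B.IsTensorial a Θ) (w : B.Connection) (L : B.InvariantLift)
    (ξ : VecField EX X) : B.IsHorizontal (covDInterior D w.form (L.lift ξ).val Θ) := by
  cases p with
  | zero => exact fun u v hv => hv.choose.elim0
  | succ p => exact (h.iprod_lift L ξ).isHorizontal_covD ha hD w

/-- Horizontality is not visible from `d ι + ι d`, since `dΘ` need not be horizontal. Rewritten with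
a connection, all three terms are horizontal. -/
theorem IsTensorial.lieD_lift {a : G → V →L[ℝ] V}
    (ha : MDifferentiableAt 𝓘(ℝ, EG) 𝓘(ℝ, V →L[ℝ] V) a 1)
    {Θ : Form EP P p V} (h : B.IsTensorial a Θ) (w : B.Connection) (L : B.InvariantLift)
    (ξ : VecField EX X) : B.IsTensorial a (lieD (L.lift ξ).val Θ) := by
  have hs := smoothFormOn_univ_iff.1 h.smooth
  have hZ := (L.lift ξ).smoothVecAt
  refine ⟨smoothFormOn_univ_iff.2 fun u =>
    SmoothFormAt.lieD (Filter.Eventually.of_forall hZ) (Filter.Eventually.of_forall hs),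
    fun u v hv => ?_, fun g u => ?_⟩
  · rw [lieD_eq_covD (L.lift ξ).val (tmap a 1) w.form Θ]
    have h1 := (h.isHorizontal_covD ha rfl w).iprod (L.lift ξ).val u v hv
    have h2 := isHorizontal_covDInterior ha rfl h w L ξ u v hv
    have h3 := IsHorizontal.wedgeZero h.horizontal (tmap a 1)
      (iprod (L.lift ξ).val w.form) u v hv
    have e : ∀ Θ₁ Θ₂ Θ₃ : Form EP P p V,
      (Θ₁ + Θ₂ - Θ₃) u v = Θ₁ u v + Θ₂ u v - Θ₃ u v := fun _ _ _ => rfl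
    rw [e, h1, h2, h3, add_zero, sub_zero]
  · exact lieD_equivariant (B.contMDiff_act_right g) hZ (L.invariant ξ g) hs _ (h.equivariant g) u

/-- The connection form is not horizontal, but its curvature is, and so is the covariant derivative
of the tensorial function `λ`. -/
theorem Connection.lieD_lift_isTensorial (w : B.Connection) (L : B.InvariantLift)
    (ξ : VecField EX X) : B.IsTensorial Ad (lieD (L.lift ξ).val w.form) := by
  have hs := smoothFormOn_univ_iff.1 w.smooth
  have hZ := (L.lift ξ).smoothVecAt
  refine ⟨smoothFormOn_univ_iff.2 fun u =>
    SmoothFormAt.lieD (Filter.Eventually.of_forall hZ) (Filter.Eventually.of_forall hs),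
    fun u v hv => ?_, fun g u => ?_⟩
  · rw [lieD_one_form (L.lift ξ).val (lieBr_skew G) w.form]
    have h1 := w.isHorizontal_curvature.iprod (L.lift ξ).val u v hv
    have h2 := (L.lamTotal_isTensorial w ξ).isHorizontal_covD
      (contMDiffAt_Ad.mdifferentiableAt (by simp)) tmap_Ad w u v hv
    change CovLie.iprod _ (curvature G w.form) u v +
      covD (lieBr EG G) w.form (L.lamTotal w ξ) u v = 0
    rw [h1, h2, add_zero]
  · exact lieD_equivariant (B.contMDiff_act_right g) hZ (L.invariant ξ g) hs _ (w.equivariant g) u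

/-- Pullback along a section of the contraction of a horizontal form with a lift. -/
theorem IsHorizontal.pullback_iprod_lift {Θ : Form EP P (p + 1) V} (h : B.IsHorizontal Θ)
    (L : B.InvariantLift) (ξ : VecField EX X) (σ : B.LocalSection) {x : X} (hx : x ∈ σ.dom) :
    pullback σ.toFun (CovLie.iprod (L.lift ξ).val Θ) x =
      CovLie.iprod ξ.val (pullback σ.toFun Θ) x := by
  ext v
  simp only [pullback_apply, iprod_apply]
  refine horizontal_congr (h _) fun i => ?_
  refine Fin.cases ?_ (fun j => ?_) i
  · simp only [Fin.cons_zero]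
    rw [L.proj_lift, σ.tmap_proj hx, σ.proj_toFun x hx]
  · simp only [Fin.cons_succ]

theorem IsTensorial.pullback_covDInterior {a : G → V →L[ℝ] V} {D : EG →L[ℝ] V →L[ℝ] V}
    {Θ : Form EP P p V} (h : B.IsTensorial a Θ) (w : B.Connection) (L : B.InvariantLift)
    (ξ : VecField EX X) (σ : B.LocalSection) {x : X} (hx : x ∈ σ.dom) :
    pullback σ.toFun (covDInterior D w.form (L.lift ξ).val Θ) x =
      covDInterior D (pullback σ.toFun w.form) ξ.val (pullback σ.toFun Θ) x := by
  cases p with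
  | zero =>
    ext v
    rfl
  | succ p =>
    simp only [covDInterior]
    rw [← covD_pullback (σ.contMDiffAt hx) D w.form
      (smoothFormOn_univ_iff.1 (h.iprod_lift L ξ).smooth _)]
    -- `covD` differentiates, so the contractions must agree on a neighbourhood of `x`, which the
    -- open domain of `σ` supplies.
    refine covD_congr _ _ ?_
    filter_upwards [σ.isOpen_dom.mem_nhds hx] with y hy
    exact IsHorizontal.pullback_iprod_lift h.horizontal L ξ σ hy

/-- The local formula for the covariant Lie derivative of a tensorial form. -/
theorem IsTensorial.pullback_lieD {a : G → V →L[ℝ] V} {D : EG →L[ℝ] V →L[ℝ] V}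
    (ha : MDifferentiableAt 𝓘(ℝ, EG) 𝓘(ℝ, V →L[ℝ] V) a 1) (hD : tmap a 1 = D)
    {Θ : Form EP P p V} (h : B.IsTensorial a Θ) (w : B.Connection) (L : B.InvariantLift)
    (ξ : VecField EX X) (σ : B.LocalSection) {x : X} (hx : x ∈ σ.dom) :
    pullback σ.toFun (lieD (L.lift ξ).val Θ) x =
      (iprod ξ.val (covD D (B.localReps w.form σ) (pullback σ.toFun Θ))
        + covDInterior D (B.localReps w.form σ) ξ.val (pullback σ.toFun Θ)
        - wedgeZero D (B.localReps (L.lamTotal w ξ) σ) (pullback σ.toFun Θ)) x := by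
  rw [lieD_eq_covD (L.lift ξ).val D w.form Θ]
  have e : ∀ Θ₁ Θ₂ Θ₃ : Form EP P p V, pullback (E := EX) σ.toFun (Θ₁ + Θ₂ - Θ₃) x =
    pullback σ.toFun Θ₁ x + pullback σ.toFun Θ₂ x - pullback σ.toFun Θ₃ x := fun _ _ _ => rfl
  rw [e, (h.isHorizontal_covD ha hD w).pullback_iprod_lift L ξ σ hx,
    h.pullback_covDInterior w L ξ σ hx, pullback_wedgeZero]
  have e2 := covD_pullback (σ.contMDiffAt hx) D w.form (smoothFormOn_univ_iff.1 h.smooth _)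
  have e3 : CovLie.iprod ξ.val (pullback σ.toFun (covD D w.form Θ)) x =
      CovLie.iprod ξ.val (covD D (pullback σ.toFun w.form) (pullback σ.toFun Θ)) x := by
    simp only [CovLie.iprod, e2]
  rw [e3]
  rfl

theorem Connection.pullback_lieD (w : B.Connection) (L : B.InvariantLift)
    (ξ : VecField EX X) (σ : B.LocalSection) {x : X} (hx : x ∈ σ.dom) :
    pullback σ.toFun (lieD (L.lift ξ).val w.form) x =
      (iprod ξ.val (curvature G (B.localReps w.form σ))
        + covD (lieBr EG G) (B.localReps w.form σ) (B.localReps (L.lamTotal w ξ) σ)) x := by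
  rw [lieD_one_form (L.lift ξ).val (lieBr_skew G) w.form]
  change pullback σ.toFun (CovLie.iprod (L.lift ξ).val (curvature G w.form)) x +
    pullback σ.toFun (covD (lieBr EG G) w.form (L.lamTotal w ξ)) x = _
  rw [w.isHorizontal_curvature.pullback_iprod_lift L ξ σ hx,
    ← covD_pullback (σ.contMDiffAt hx) _ _
      (smoothFormOn_univ_iff.1 (L.lamTotal_isTensorial w ξ).smooth _)]
  have e2 := curvature_pullback G (σ.contMDiffAt hx) (smoothFormOn_univ_iff.1 w.smooth _)
  have e3 : CovLie.iprod ξ.val (pullback σ.toFun (curvature G w.form)) x =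
      CovLie.iprod ξ.val (curvature G (pullback σ.toFun w.form)) x := by
    simp only [CovLie.iprod, e2]
  rw [e3]
  rfl

end
end PrincipalBundle

end CovLie

end

/-! ### The covariant Lie derivative formulas -/

open CovLie in
theorem mainTheorem4
    {EX : Type*} [NormedAddCommGroup EX] [NormedSpace ℝ EX] [FiniteDimensional ℝ EX]
    {X : Type*} [TopologicalSpace X] [ChartedSpace EX X] [IsManifold 𝓘(ℝ, EX) ∞ X]
    {EG : Type*} [NormedAddCommGroup EG] [NormedSpace ℝ EG] [FiniteDimensional ℝ EG]
    {G : Type*} [TopologicalSpace G] [ChartedSpace EG G] [Group G] [LieGroup 𝓘(ℝ, EG) ∞ G]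
    {EP : Type*} [NormedAddCommGroup EP] [NormedSpace ℝ EP] [FiniteDimensional ℝ EP]
    {P : Type*} [TopologicalSpace P] [ChartedSpace EP P] [IsManifold 𝓘(ℝ, EP) ∞ P]
    {V : Type*} [NormedAddCommGroup V] [NormedSpace ℝ V] [FiniteDimensional ℝ V]
    (B : PrincipalBundle EX X EG G EP P) (r : SmoothRep EG G V)
    (L : B.InvariantLift) (w : B.Connection) (ξ : VecField EX X) :
    -- the function on `P` given by contracting the lift with the connection is a section
    B.Corresponds Ad (B.localReps (L.lamTotal w ξ)) (L.lamTotal w ξ) ∧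
    -- matter fields
    (∀ (p : ℕ) (φ : B.LocalFamily p V), B.IsAssociatedForm r.toHom φ →
      B.Corresponds r.toHom φ (B.totalForm φ) ∧
      B.Corresponds r.toHom (L.covLieForm ξ φ) (lieD (L.lift ξ).val (B.totalForm φ)) ∧
      ∀ σ : B.LocalSection, ∀ x ∈ σ.dom,
        L.covLieForm ξ φ σ x =
          (iprod ξ.val (covD r.derived (B.localReps w.form σ) (φ σ))
            + covDInterior r.derived (B.localReps w.form σ) ξ.val (φ σ)
            - wedgeZero r.derived (B.localReps (L.lamTotal w ξ) σ) (φ σ)) x ∧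
        L.covLieForm ξ φ σ x =
          (lieD ξ.val (φ σ)
            + wedgeZero r.derived
                (iprod ξ.val (B.localReps w.form σ)
                  - B.localReps (L.lamTotal w ξ) σ) (φ σ)) x) ∧
    -- the connection
    (B.Corresponds Ad (L.covLieConnection ξ w) (lieD (L.lift ξ).val w.form) ∧
      ∀ σ : B.LocalSection, ∀ x ∈ σ.dom,
        L.covLieConnection ξ w σ x =
          (iprod ξ.val (curvature G (B.localReps w.form σ))
            + covD (lieBr EG G) (B.localReps w.form σ)
                (B.localReps (L.lamTotal w ξ) σ)) x ∧
        L.covLieConnection ξ w σ x =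
          (lieD ξ.val (B.localReps w.form σ)
            - covD (lieBr EG G) (B.localReps w.form σ)
                (iprod ξ.val (B.localReps w.form σ)
                  - B.localReps (L.lamTotal w ξ) σ)) x) := by
  refine ⟨(L.lamTotal_isTensorial w ξ).corresponds, fun p φ h => ⟨h.corresponds, ?_, ?_⟩,
    (w.lieD_lift_isTensorial L ξ).corresponds, fun σ x hx => ?_⟩
  · exact (h.isTensorial.lieD_lift (r.smooth.mdifferentiable (by simp) 1) w L ξ).corresponds
  · intro σ x hx
    -- `φ σ` is the pullback of the total form only on the domain of `σ`; equality near `x` suffices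
    -- because all operators involved are local.
    have hloc : φ σ =ᶠ[𝓝 x] pullback σ.toFun (B.totalForm φ) := by
      filter_upwards [σ.isOpen_dom.mem_nhds hx] with y hy
      exact h.corresponds.2.2 σ y hy
    have h1 : L.covLieForm ξ φ σ x =
        iprod ξ.val (covD r.derived (B.localReps w.form σ) (φ σ)) x
          + covDInterior r.derived (B.localReps w.form σ) ξ.val (φ σ) x
          - wedgeZero r.derived (B.localReps (L.lamTotal w ξ) σ) (φ σ) x := by
      rw [covDInterior_congr _ _ _ hloc]
      simp only [iprod, wedgeZero, covD_congr _ _ hloc, hloc.eq_of_nhds]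
      exact h.isTensorial.pullback_lieD (r.smooth.mdifferentiable (by simp) 1) rfl w L ξ σ hx
    refine ⟨h1, h1.trans ?_⟩
    -- The second formula is the same algebraic identity, now on `X` with the local gauge field as
    -- the 1-form.
    rw [lieD_eq_covD ξ.val r.derived (B.localReps w.form σ) (φ σ), wedgeZero_sub]
    simp only [Pi.add_apply, Pi.sub_apply]
    abel
  · have h1 := w.pullback_lieD L ξ σ hx
    refine ⟨h1, h1.trans ?_⟩
    have hσ := σ.contMDiffAt hx
    -- On `X` the local gauge field satisfies `L_ξ ω = ι_ξ F_ω + d^ω (ι_ξ ω)`; splitting `d^ω` of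
    -- the difference requires both functions to be smooth at `x`.
    rw [lieD_one_form ξ.val (lieBr_skew G), Pi.sub_apply, Pi.add_apply, Pi.add_apply, covD_sub]
    · rw [curvature]
      abel
    · exact ((smoothFormOn_univ_iff.1 w.smooth _).pullback hσ).iprod (ξ.smoothVecAt x)
    · exact (smoothFormOn_univ_iff.1 (L.lamTotal_isTensorial w ξ).smooth _).pullback hσ
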